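/- Let $A\in\mathbb R^{n\times n}$, $B^L\in\mathbb R^{n\times l}$, $B^R\in\mathbb R^{n\times r}$, $p\in[0,1]$, and consider the noise-free system $$x_{k+1}=Ax_k+B^Lu^L_k+B^Ru^R_k,\qquad k\ge 0,$$ where $x_0$ is a Gaussian random vector (its mean and its positive semi-definite covariance are arbitrary). The state is sent over a lossy channel: $\eta_0,\eta_1,\dots$ are i.i.d. Bernoulli variables, independent of $x_0$, with $P(\eta_k=0)=p$ and $P(\eta_k=1)=1-p$; the received signal is $y_k=x_k$ if $\eta_k=1$ and $y_k=\emptyset$ (packet lost) if $\eta_k=0$. Put $\hat x_{k|k}=E[x_k\mid y_0,\dots,y_k]$ and $\tilde x_k=x_k-\hat x_{k|k}$. A pair of controls is admissible if, for every $k$, $u^R_k$ is $\sigma(y_0,\dots,y_k)$-measurable and $u^L_k$ is $\sigma(x_0,y_0,\dots,y_k)$-measurable. The cost is $$J=E\sum_{k=0}^\infty\left[x_k'Qx_k+(u^L_k)'R^Lu^L_k+(u^R_k)'R^Ru^R_k\right]\in[0,\infty].$$ The system is called mean-square stabilizable if there are constant matrices $K_1,K_2,L$ such that, with $u^R_k=-K_1\hat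 x_{k|k}$ and $u^L_k=-K_2\hat x_{k|k}-L\tilde x_k$, one has $\lim_{k\to\infty}E(x_k'x_k)=0$ for every Gaussian initial value $x_0$. Assume that $R^L>0$ and $R^R>0$ (symmetric positive definite), that $Q=C'C$ for some matrix $C$, and that $(A,Q^{1/2})$ is observable. Then the system is mean-square stabilizable if and only if there is exactly one pair $(Z,X)$ of real $n\times n$ matrices that solves the algebraic Riccati equations $$Z=A'ZA+Q-K'\Upsilon K,\qquad X=A'\Psi A+Q-M'\Lambda^{-1}M,$$ where $$K=\Upsilon^{-1}[B^L\ B^R]'ZA,\qquad \Upsilon=[B^L\ B^R]'Z[B^L\ B^R]+\begin{bmatrix}R^L&0\\0&R^R\end{bmatrix},$$ $$\Psi=(1-p)Z+pX,\qquad \Lambda=(B^L)'\Psi B^L+R^L,\qquad M=(B^L)'\Psi A,$$ and satisfies $Z>0$, $\Psi>0$ and $E[x_0'Z\hat x_{0|0}+x_0'X\tilde x_0]\ge 0$ for every Gaussian initial value $x_0$. In that case the stationary controls $$u^R_k=-[0\ \ I]\,K\hat x_{k|k},\qquad u^L_k=-[I\ \ 0]\,K\hat x_{k|k}-\Lambda^{-1}M\tilde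 x_k$$ stabilize the system in the mean-square sense (that is, $E(x_k'x_k)\to0$ for every Gaussian $x_0$), are admissible, and minimize $J$ over all admissible pairs of controls, for every Gaussian initial value $x_0$; the optimal cost is $$J^*=E[x_0'Z\hat x_{0|0}+x_0'X\tilde x_0].$$ -/

import Mathlib

open Filter Topology MeasureTheory ProbabilityTheory Matrix
open scoped ENNReal MatrixOrder

noncomputable section

/-- The data of the noise-free networked control system
`x (k+1) = A x k + BL uL k + BR uR k` with state dimension `n`, local control dimension `l`,
remote control dimension `r`, weights `Q`, `RL`, `RR`, and packet loss probability `p`. -/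
structure NCS (n l r : ℕ) where
  A : Matrix (Fin n) (Fin n) ℝ
  BL : Matrix (Fin n) (Fin l) ℝ
  BR : Matrix (Fin n) (Fin r) ℝ
  Q : Matrix (Fin n) (Fin n) ℝ
  RL : Matrix (Fin l) (Fin l) ℝ
  RR : Matrix (Fin r) (Fin r) ℝ
  p : ℝ

/-- `(A, C)` is observable: a free trajectory with zero output starts at `0`. -/
def Observable {n m : ℕ} (A : Matrix (Fin n) (Fin n) ℝ) (C : Matrix (Fin m) (Fin n) ℝ) : Prop :=
  ∀ v : Fin n → ℝ, (∀ k : ℕ, C *ᵥ ((A ^ k) *ᵥ v) = 0) → v = 0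

/-- Probabilistic setting: `x0` is Gaussian (with arbitrary mean and arbitrary, possibly singular,
covariance), the packet arrivals `η k` are independent and identically distributed with
`P (η k = 0) = p`, and the arrival sequence is independent of `x0`. -/
structure IsSetting {Ω : Type*} [MeasurableSpace Ω] (μ : Measure Ω) {n : ℕ} (p : ℝ)
    (x0 : Ω → Fin n → ℝ) (η : ℕ → Ω → Bool) : Prop where
  measurable_x0 : Measurable x0
  gaussian_x0 : IsGaussian (μ.map x0)
  measurable_η : ∀ k, Measurable (η k)
  prob_loss : ∀ k, μ {ω | η k ω = false} = ENNReal.ofReal p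
  indep_η : iIndepFun η μ
  indep_x0_η : IndepFun x0 (fun ω k => η k ω) μ

/-- The signal received by the remote controller when the arrival flag is `b` and the state is `v`:
the state, or an erasure symbol, here `(false, 0)`. -/
def received {n : ℕ} (b : Bool) (v : Fin n → ℝ) : Bool × (Fin n → ℝ) :=
  (b, if b then v else 0)

/-- The σ-algebra generated by the received signals `y 0, …, y k` along the state process `x`. -/
@[reducible] def remoteSigma {Ω : Type*} {n : ℕ} (η : ℕ → Ω → Bool) (x : ℕ → Ω → Fin n → ℝ) (k : ℕ) :
    MeasurableSpace Ω :=
  ⨆ j : Fin (k + 1), MeasurableSpace.comap (fun ω => received (η j ω) (x j ω)) inferInstance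

/-- The σ-algebra generated by `x 0` and the received signals `y 0, …, y k`. -/
@[reducible] def localSigma {Ω : Type*} {n : ℕ} (η : ℕ → Ω → Bool) (x : ℕ → Ω → Fin n → ℝ) (k : ℕ) :
    MeasurableSpace Ω :=
  MeasurableSpace.comap (x 0) inferInstance ⊔ remoteSigma η x k

/-- The remote estimate: the conditional expectation of `x k` given `y 0, …, y k`. -/
def estimate {Ω : Type*} [MeasurableSpace Ω] (μ : Measure Ω) {n : ℕ}
    (η : ℕ → Ω → Bool) (x : ℕ → Ω → Fin n → ℝ) (k : ℕ) : Ω → Fin n → ℝ :=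
  μ[x k | remoteSigma η x k]

/-- The estimation error. -/
def estError {Ω : Type*} [MeasurableSpace Ω] (μ : Measure Ω) {n : ℕ}
    (η : ℕ → Ω → Bool) (x : ℕ → Ω → Fin n → ℝ) (k : ℕ) : Ω → Fin n → ℝ :=
  fun ω => x k ω - estimate μ η x k ω

/-- The remote feedback `-K1 x̂`. -/
def remoteFeedback {Ω : Type*} [MeasurableSpace Ω] (μ : Measure Ω) {n r : ℕ}
    (η : ℕ → Ω → Bool) (K1 : Matrix (Fin r) (Fin n) ℝ) (x : ℕ → Ω → Fin n → ℝ) (k : ℕ) :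
    Ω → Fin r → ℝ :=
  fun ω => -(K1 *ᵥ estimate μ η x k ω)

/-- The local feedback `-K2 x̂ - L x̃`. -/
def localFeedback {Ω : Type*} [MeasurableSpace Ω] (μ : Measure Ω) {n l : ℕ}
    (η : ℕ → Ω → Bool) (K2 L : Matrix (Fin l) (Fin n) ℝ) (x : ℕ → Ω → Fin n → ℝ) (k : ℕ) :
    Ω → Fin l → ℝ :=
  fun ω => -(K2 *ᵥ estimate μ η x k ω) - L *ᵥ estError μ η x k ω

namespace NCS

variable {n l r : ℕ} (S : NCS n l r)

/-- `x` is the state process started at `x0` and driven by the controls `uL`, `uR`. -/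
def IsTrajectory {Ω : Type*} (x0 : Ω → Fin n → ℝ) (uL : ℕ → Ω → Fin l → ℝ)
    (uR : ℕ → Ω → Fin r → ℝ) (x : ℕ → Ω → Fin n → ℝ) : Prop :=
  x 0 = x0 ∧ ∀ k ω, x (k + 1) ω = S.A *ᵥ x k ω + S.BL *ᵥ uL k ω + S.BR *ᵥ uR k ω

/-- Admissible controls with the state process that they generate: the remote control at time `k`
is a function of `y 0, …, y k`, the local control a function of `x 0, y 0, …, y k`. -/
def IsAdmissible {Ω : Type*} (x0 : Ω → Fin n → ℝ) (η : ℕ → Ω → Bool)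
    (uL : ℕ → Ω → Fin l → ℝ) (uR : ℕ → Ω → Fin r → ℝ) (x : ℕ → Ω → Fin n → ℝ) : Prop :=
  S.IsTrajectory x0 uL uR x ∧
    (∀ k, Measurable[localSigma η x k] (uL k)) ∧ (∀ k, Measurable[remoteSigma η x k] (uR k))

/-- The infinite-horizon cost `E ∑ (x' Q x + uL' RL uL + uR' RR uR)`, possibly infinite. It is
used for positive semi-definite weights only. -/
def cost {Ω : Type*} [MeasurableSpace Ω] (μ : Measure Ω) (uL : ℕ → Ω → Fin l → ℝ)
    (uR : ℕ → Ω → Fin r → ℝ) (x : ℕ → Ω → Fin n → ℝ) : ℝ≥0∞ :=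
  ∫⁻ ω, ∑' k, ENNReal.ofReal (x k ω ⬝ᵥ S.Q *ᵥ x k ω + uL k ω ⬝ᵥ S.RL *ᵥ uL k ω
    + uR k ω ⬝ᵥ S.RR *ᵥ uR k ω) ∂μ

/-- The state process of the closed loop under `uR = -K1 x̂` and `uL = -K2 x̂ - L x̃`. The estimate
at time `k` is written out here so that the recursion over the past states is visible; the closed
loop equation in terms of the feedbacks is `closedLoop_isTrajectory`. -/
def closedLoop {Ω : Type*} [MeasurableSpace Ω] (μ : Measure Ω) (x0 : Ω → Fin n → ℝ)
    (η : ℕ → Ω → Bool) (K1 : Matrix (Fin r) (Fin n) ℝ) (K2 L : Matrix (Fin l) (Fin n) ℝ) :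
    ℕ → Ω → Fin n → ℝ
  | 0 => x0
  | k + 1 => fun ω =>
      let xk : Ω → Fin n → ℝ := closedLoop μ x0 η K1 K2 L k
      let m : MeasurableSpace Ω := ⨆ j : Fin (k + 1), MeasurableSpace.comap
        (fun ω => received (η j ω) (closedLoop μ x0 η K1 K2 L j ω)) inferInstance
      let xhat : Fin n → ℝ := (μ[xk | m]) ω
      S.A *ᵥ xk ω + S.BL *ᵥ (-(K2 *ᵥ xhat) - L *ᵥ (xk ω - xhat)) + S.BR *ᵥ (-(K1 *ᵥ xhat))
  termination_by k => k
  decreasing_by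
    · omega
    · exact j.isLt

theorem closedLoop_isTrajectory {Ω : Type*} [MeasurableSpace Ω] (μ : Measure Ω)
    (x0 : Ω → Fin n → ℝ) (η : ℕ → Ω → Bool) (K1 : Matrix (Fin r) (Fin n) ℝ)
    (K2 L : Matrix (Fin l) (Fin n) ℝ) :
    S.IsTrajectory x0 (localFeedback μ η K2 L (S.closedLoop μ x0 η K1 K2 L))
      (remoteFeedback μ η K1 (S.closedLoop μ x0 η K1 K2 L)) (S.closedLoop μ x0 η K1 K2 L) := by
  refine ⟨by rw [closedLoop], fun k ω => ?_⟩
  rw [closedLoop]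
  rfl

/-- The closed loop with gains `K1`, `K2`, `L`, started at `x0`, satisfies `E (x k)'(x k) → 0`. -/
def TendsToZeroInMeanSquare {Ω : Type*} [MeasurableSpace Ω] (μ : Measure Ω) (x0 : Ω → Fin n → ℝ)
    (η : ℕ → Ω → Bool) (K1 : Matrix (Fin r) (Fin n) ℝ) (K2 L : Matrix (Fin l) (Fin n) ℝ) : Prop :=
  Tendsto (fun k => ∫⁻ ω, ENNReal.ofReal
    (S.closedLoop μ x0 η K1 K2 L k ω ⬝ᵥ S.closedLoop μ x0 η K1 K2 L k ω) ∂μ) atTop (𝓝 0)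

/-- The controls `uR = -K1 x̂`, `uL = -K2 x̂ - L x̃` stabilize the system in the mean-square sense:
for every Gaussian initial value the closed-loop state tends to zero in mean square. -/
def StabilizedBy (K1 : Matrix (Fin r) (Fin n) ℝ) (K2 L : Matrix (Fin l) (Fin n) ℝ) : Prop :=
  ∀ (Ω : Type) [MeasurableSpace Ω] (μ : Measure Ω) [IsProbabilityMeasure μ]
    (x0 : Ω → Fin n → ℝ) (η : ℕ → Ω → Bool), IsSetting μ S.p x0 η →
    S.TendsToZeroInMeanSquare μ x0 η K1 K2 L

/-- Mean-square stabilizability by constant gains. -/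
def MeanSquareStabilizable : Prop :=
  ∃ (K1 : Matrix (Fin r) (Fin n) ℝ) (K2 L : Matrix (Fin l) (Fin n) ℝ), S.StabilizedBy K1 K2 L

/-- The block matrix `[BL BR]`. -/
def B : Matrix (Fin n) (Fin l ⊕ Fin r) ℝ := Matrix.fromCols S.BL S.BR

def Upsilon (Z : Matrix (Fin n) (Fin n) ℝ) : Matrix (Fin l ⊕ Fin r) (Fin l ⊕ Fin r) ℝ :=
  S.Bᵀ * Z * S.B + Matrix.fromBlocks S.RL 0 0 S.RR

def K (Z : Matrix (Fin n) (Fin n) ℝ) : Matrix (Fin l ⊕ Fin r) (Fin n) ℝ :=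
  (S.Upsilon Z)⁻¹ * S.Bᵀ * Z * S.A

def Psi (Z X : Matrix (Fin n) (Fin n) ℝ) : Matrix (Fin n) (Fin n) ℝ :=
  (1 - S.p) • Z + S.p • X

def Lambda (Z X : Matrix (Fin n) (Fin n) ℝ) : Matrix (Fin l) (Fin l) ℝ :=
  S.BLᵀ * S.Psi Z X * S.BL + S.RL

def M (Z X : Matrix (Fin n) (Fin n) ℝ) : Matrix (Fin l) (Fin n) ℝ :=
  S.BLᵀ * S.Psi Z X * S.A

/-- `E [x0' Z x̂ + x0' X x̃]`, with the estimate `x̂` of `x0` given `y 0` and its error `x̃`. -/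
def initialValue {Ω : Type*} [MeasurableSpace Ω] (μ : Measure Ω) (x0 : Ω → Fin n → ℝ)
    (η : ℕ → Ω → Bool) (Z X : Matrix (Fin n) (Fin n) ℝ) : ℝ :=
  ∫ ω, (x0 ω ⬝ᵥ Z *ᵥ estimate μ η (fun _ => x0) 0 ω
    + x0 ω ⬝ᵥ X *ᵥ estError μ η (fun _ => x0) 0 ω) ∂μ

/-- `Z` and `X` solve the two coupled algebraic Riccati equations, with `Z > 0`, `Ψ > 0` and
`E [x0' Z x̂ + x0' X x̃] ≥ 0` for every Gaussian initial value `x0`. -/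
structure IsRiccatiSolution (Z X : Matrix (Fin n) (Fin n) ℝ) : Prop where
  eq_Z : Z = S.Aᵀ * Z * S.A + S.Q - (S.K Z)ᵀ * S.Upsilon Z * S.K Z
  eq_X : X = S.Aᵀ * S.Psi Z X * S.A + S.Q - (S.M Z X)ᵀ * (S.Lambda Z X)⁻¹ * S.M Z X
  posDef_Z : Z.PosDef
  posDef_Psi : (S.Psi Z X).PosDef
  nonneg : ∀ (Ω : Type) [MeasurableSpace Ω] (μ : Measure Ω) [IsProbabilityMeasure μ]
    (x0 : Ω → Fin n → ℝ) (η : ℕ → Ω → Bool), IsSetting μ S.p x0 η →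
    0 ≤ initialValue μ x0 η Z X

/-- The stationary remote gain `[0 I] K`. -/
def remoteGain (Z : Matrix (Fin n) (Fin n) ℝ) : Matrix (Fin r) (Fin n) ℝ := (S.K Z).toRows₂

/-- The stationary local gain `[I 0] K`. -/
def localGain (Z : Matrix (Fin n) (Fin n) ℝ) : Matrix (Fin l) (Fin n) ℝ := (S.K Z).toRows₁

/-- The stationary local gain `Λ⁻¹ M` on the estimation error. -/
def errorGain (Z X : Matrix (Fin n) (Fin n) ℝ) : Matrix (Fin l) (Fin n) ℝ :=
  (S.Lambda Z X)⁻¹ * S.M Z X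

end NCS

end

/-!
Decompose the state as `x = x̂ + x̃`, the estimate of the remote controller and its error, which
are orthogonal in mean square. The controls enter the estimate only through the stacked control
seen by the remote controller, and the error only through the part of `uL` unknown to it; when
the next packet is lost the new error stays in the error, and otherwise it is absorbed by the
estimate, so that its weight becomes `Ψ = (1 - p) Z + p X`. Completing the square in both
controls then shows that the running cost at time `k` equals the decrease of
`E [x̂' Z x̂ + x̃' X x̃]` plus two nonnegative quadratic terms that vanish exactly at the
stationary controls. Observability forces the state of every control of finite cost to zero in mean
square, so summing this identity gives optimality and the optimal cost.

Conversely, run on Gaussian initial values `v + g w` with `g` standard normal, stabilizing gains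
show that the powers of `A - B K` and, weighted by `pᵏ`, of `A - BL L` are stable, and value
iteration started at `0` converges to a solution of the Riccati equations. On the same initial
values the optimal cost is `v' Z v + w' Ψ w`, which determines `Z` and `Ψ`, hence `X`.
-/

section QuadraticForms

variable {ι κ : Type*} [Fintype ι]

theorem dotProduct_self_nonneg (v : ι → ℝ) : 0 ≤ v ⬝ᵥ v :=
  dotProduct_self_star_nonneg v

theorem dotProduct_mulVec_self_nonneg {S : Matrix ι ι ℝ} (hS : S.PosSemidef) (v : ι → ℝ) :
    0 ≤ v ⬝ᵥ S *ᵥ v :=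
  hS.dotProduct_mulVec_nonneg v

theorem transpose_eq_of_isHermitian {ι : Type*} {S : Matrix ι ι ℝ} (hS : S.IsHermitian) :
    Sᵀ = S :=
  hS.eq

theorem dotProduct_mulVec_comm {S : Matrix ι ι ℝ} (hS : S.IsHermitian) (v w : ι → ℝ) :
    v ⬝ᵥ S *ᵥ w = w ⬝ᵥ S *ᵥ v := by
  rw [← dotProduct_transpose_mulVec, transpose_eq_of_isHermitian hS]

theorem dotProduct_mulVec_le_of_le {V W : Matrix ι ι ℝ} (h : V ≤ W) (v : ι → ℝ) :
    v ⬝ᵥ V *ᵥ v ≤ v ⬝ᵥ W *ᵥ v := by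
  have := dotProduct_mulVec_self_nonneg (le_iff.mp h) v
  rwa [sub_mulVec, dotProduct_sub, sub_nonneg] at this

theorem le_of_forall_dotProduct_mulVec_le {V W : Matrix ι ι ℝ} (hV : V.IsHermitian)
    (hW : W.IsHermitian) (h : ∀ v : ι → ℝ, v ⬝ᵥ V *ᵥ v ≤ v ⬝ᵥ W *ᵥ v) : V ≤ W := by
  refine le_iff.mpr (PosSemidef.of_dotProduct_mulVec_nonneg (hW.sub hV) fun v => ?_)
  rw [star_trivial, sub_mulVec, dotProduct_sub]
  exact sub_nonneg.mpr (h v)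

theorem eq_of_forall_dotProduct_mulVec_eq {V W : Matrix ι ι ℝ} (hV : V.IsHermitian)
    (hW : W.IsHermitian) (h : ∀ v : ι → ℝ, v ⬝ᵥ V *ᵥ v = v ⬝ᵥ W *ᵥ v) : V = W :=
  le_antisymm (le_of_forall_dotProduct_mulVec_le hV hW fun v => (h v).le)
    (le_of_forall_dotProduct_mulVec_le hW hV fun v => (h v).ge)

theorem posSemidef_of_tendsto {ι : Type*} [Finite ι] {S : ℕ → Matrix ι ι ℝ}
    {T : Matrix ι ι ℝ} (hS : ∀ k, (S k).PosSemidef) (h : Tendsto S atTop (𝓝 T)) : T.PosSemidef := by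
  cases nonempty_fintype ι
  refine PosSemidef.of_dotProduct_mulVec_nonneg ?_ fun v => ?_
  · refine tendsto_nhds_unique (((continuous_id.matrix_conjTranspose.tendsto T).comp h).congr
      fun k => ?_) h
    exact (hS k).isHermitian
  · have hv : Continuous fun S : Matrix ι ι ℝ => star v ⬝ᵥ S *ᵥ v :=
      continuous_const.dotProduct (continuous_id.matrix_mulVec continuous_const)
    exact ge_of_tendsto' ((hv.tendsto T).comp h) fun k => (hS k).dotProduct_mulVec_nonneg v

theorem exists_tendsto_of_forall_tendsto_dotProduct_mulVec {X : ℕ → Matrix ι ι ℝ}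
    (hX : ∀ k, (X k).IsHermitian)
    (h : ∀ v : ι → ℝ, ∃ a, Tendsto (fun k => v ⬝ᵥ X k *ᵥ v) atTop (𝓝 a)) :
    ∃ Y, Tendsto X atTop (𝓝 Y) := by
  classical
  choose a ha using h
  have polarization (k : ℕ) (i j : ι) : X k i j = ((Pi.single i 1 + Pi.single j 1) ⬝ᵥ
      X k *ᵥ (Pi.single i 1 + Pi.single j 1) - Pi.single i 1 ⬝ᵥ X k *ᵥ Pi.single i 1
      - Pi.single j 1 ⬝ᵥ X k *ᵥ Pi.single j 1) / 2 := by
    have : X k j i = X k i j := (hX k).apply i j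
    simp only [mulVec_add, add_dotProduct, dotProduct_add, single_one_dotProduct, mulVec_single_one,
      col_apply, this]
    ring
  refine ⟨fun i j => (a (Pi.single i 1 + Pi.single j 1) - a (Pi.single i 1)
    - a (Pi.single j 1)) / 2, tendsto_pi_nhds.mpr fun i => tendsto_pi_nhds.mpr fun j => ?_⟩
  simp_rw [polarization]
  exact (((ha _).sub (ha _)).sub (ha _)).div_const 2

theorem posSemidef_transpose_mul_mul_same [Finite κ] {S : Matrix ι ι ℝ} (hS : S.PosSemidef)
    (B : Matrix ι κ ℝ) : (Bᵀ * S * B).PosSemidef :=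
  hS.conjTranspose_mul_mul_same B

theorem posDef_transpose_mul_mul_add [Finite κ] {V : Matrix ι ι ℝ} {R : Matrix κ κ ℝ}
    (B : Matrix ι κ ℝ) (hR : R.PosDef) (hV : V.PosSemidef) : (Bᵀ * V * B + R).PosDef :=
  hR.posSemidef_add (posSemidef_transpose_mul_mul_same hV B)

variable [Fintype κ]

theorem dotProduct_transpose_mul_mul_mulVec (M : Matrix ι κ ℝ) (S : Matrix ι ι ℝ) (v : κ → ℝ) :
    v ⬝ᵥ (Mᵀ * S * M) *ᵥ v = M *ᵥ v ⬝ᵥ S *ᵥ (M *ᵥ v) := by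
  rw [← mulVec_mulVec, ← mulVec_mulVec, dotProduct_transpose_mulVec, dotProduct_comm]

theorem dotProduct_transpose_mul_self_mulVec (M : Matrix ι κ ℝ) (v : κ → ℝ) :
    v ⬝ᵥ (Mᵀ * M) *ᵥ v = M *ᵥ v ⬝ᵥ M *ᵥ v := by
  rw [← mulVec_mulVec, dotProduct_transpose_mulVec]

theorem dotProduct_mulVec_self_le (M : Matrix ι κ ℝ) (v : κ → ℝ) :
    M *ᵥ v ⬝ᵥ M *ᵥ v ≤ (∑ i, ∑ j, M i j ^ 2) * (v ⬝ᵥ v) := by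
  rw [dotProduct, Finset.sum_mul]
  refine Finset.sum_le_sum fun i _ => ?_
  simpa only [mulVec, dotProduct, ← sq] using
    Finset.sum_mul_sq_le_sq_mul_sq Finset.univ (M i) v

theorem exists_dotProduct_mulVec_le (S : Matrix ι ι ℝ) :
    ∃ c : ℝ, 0 ≤ c ∧ ∀ v : ι → ℝ, v ⬝ᵥ S *ᵥ v ≤ c * (v ⬝ᵥ v) := by
  refine ⟨(1 + ∑ i, ∑ j, S i j ^ 2) / 2, by positivity, fun v => ?_⟩
  have hsq := dotProduct_self_nonneg (v - S *ᵥ v)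
  simp only [sub_dotProduct, dotProduct_sub, dotProduct_comm (S *ᵥ v) v] at hsq
  linarith [dotProduct_mulVec_self_le S v]

theorem exists_dotProduct_self_le_of_posDef {S : Matrix ι ι ℝ} (hS : S.PosDef) :
    ∃ c : ℝ, 0 ≤ c ∧ ∀ v : ι → ℝ, v ⬝ᵥ v ≤ c * (v ⬝ᵥ S *ᵥ v) := by
  classical
  obtain ⟨B, rfl⟩ := CStarAlgebra.nonneg_iff_eq_star_mul_self.mp hS.posSemidef.nonneg
  have hB : IsUnit B.det := isUnit_of_mul_isUnit_right (x := (star B).det) <| by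
    rw [← det_mul]
    exact (Matrix.isUnit_iff_isUnit_det _).mp hS.isUnit
  refine ⟨∑ i, ∑ j, B⁻¹ i j ^ 2, by positivity, fun v => ?_⟩
  have h := dotProduct_mulVec_self_le B⁻¹ (B *ᵥ v)
  rw [mulVec_mulVec, nonsing_inv_mul _ hB, one_mulVec] at h
  exact h.trans_eq (by rw [← dotProduct_transpose_mul_self_mulVec]; rfl)

theorem dotProduct_sqrt_mulVec_self [DecidableEq ι] {Q : Matrix ι ι ℝ} (hQ : Q.PosSemidef)
    (v : ι → ℝ) : CFC.sqrt Q *ᵥ v ⬝ᵥ CFC.sqrt Q *ᵥ v = v ⬝ᵥ Q *ᵥ v := by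
  have hsymm : (CFC.sqrt Q)ᵀ = CFC.sqrt Q :=
    transpose_eq_of_isHermitian (CFC.sqrt_nonneg Q).posSemidef.isHermitian
  rw [← dotProduct_transpose_mul_self_mulVec, hsymm, CFC.sqrt_mul_sqrt_self Q hQ.nonneg]

theorem dotProduct_mulVec_completeSquare [DecidableEq κ] {Λ : Matrix κ κ ℝ} (hΛ : Λ.PosDef)
    (N : Matrix κ ι ℝ) (v : ι → ℝ) (u : κ → ℝ) :
    u ⬝ᵥ Λ *ᵥ u + 2 * (u ⬝ᵥ N *ᵥ v) + v ⬝ᵥ (Nᵀ * Λ⁻¹ * N) *ᵥ v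
      = (u + (Λ⁻¹ * N) *ᵥ v) ⬝ᵥ Λ *ᵥ (u + (Λ⁻¹ * N) *ᵥ v) := by
  have hcancel : Λ *ᵥ ((Λ⁻¹ * N) *ᵥ v) = N *ᵥ v := by
    rw [mulVec_mulVec,
      mul_nonsing_inv_cancel_left _ _ ((Matrix.isUnit_iff_isUnit_det _).mp hΛ.isUnit)]
  rw [mulVec_add, add_dotProduct, dotProduct_add, dotProduct_add, hcancel,
    dotProduct_mulVec_comm hΛ.isHermitian ((Λ⁻¹ * N) *ᵥ v) u, hcancel,
    dotProduct_transpose_mul_mul_mulVec, mulVec_mulVec, dotProduct_comm (N *ᵥ v)]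
  ring

end QuadraticForms

section RiccatiMap

variable {ι κ : Type*} [Fintype ι] [Fintype κ] {A Q V W : Matrix ι ι ℝ} {B : Matrix ι κ ℝ}
  {R : Matrix κ κ ℝ}

variable [DecidableEq κ]

/-- The optimal feedback gain of the one-step linear-quadratic problem with dynamics
`v ↦ A v + B u`, running weights `Q`, `R` and terminal weight `V`. -/
noncomputable def riccatiGain (A : Matrix ι ι ℝ) (B : Matrix ι κ ℝ) (R : Matrix κ κ ℝ)
    (V : Matrix ι ι ℝ) : Matrix κ ι ℝ :=
  (Bᵀ * V * B + R)⁻¹ * (Bᵀ * V * A)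

/-- The Riccati operator: the matrix of the optimal value of the one-step linear-quadratic problem
with dynamics `v ↦ A v + B u`, running weights `Q`, `R` and terminal weight `V`. -/
noncomputable def riccatiMap (A : Matrix ι ι ℝ) (B : Matrix ι κ ℝ) (Q : Matrix ι ι ℝ)
    (R : Matrix κ κ ℝ) (V : Matrix ι ι ℝ) : Matrix ι ι ℝ :=
  Aᵀ * V * A + Q - (Bᵀ * V * A)ᵀ * (Bᵀ * V * B + R)⁻¹ * (Bᵀ * V * A)

theorem riccatiMap_completeSquare (hR : R.PosDef) (hV : V.PosSemidef) (v : ι → ℝ) (u : κ → ℝ) :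
    (A *ᵥ v + B *ᵥ u) ⬝ᵥ V *ᵥ (A *ᵥ v + B *ᵥ u) + v ⬝ᵥ Q *ᵥ v + u ⬝ᵥ R *ᵥ u
      = v ⬝ᵥ riccatiMap A B Q R V *ᵥ v
        + (u + riccatiGain A B R V *ᵥ v) ⬝ᵥ (Bᵀ * V * B + R) *ᵥ (u + riccatiGain A B R V *ᵥ v) := by
  have hcross : B *ᵥ u ⬝ᵥ V *ᵥ (A *ᵥ v) = u ⬝ᵥ (Bᵀ * V * A) *ᵥ v := by
    rw [← mulVec_mulVec, ← mulVec_mulVec, dotProduct_transpose_mulVec, dotProduct_comm]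
  rw [riccatiGain, ← dotProduct_mulVec_completeSquare (posDef_transpose_mul_mul_add B hR hV),
    riccatiMap, ← hcross]
  simp only [mulVec_add, add_dotProduct, dotProduct_add, sub_mulVec, dotProduct_sub, add_mulVec,
    dotProduct_transpose_mul_mul_mulVec B V, dotProduct_transpose_mul_mul_mulVec A V,
    dotProduct_mulVec_comm hV.isHermitian (A *ᵥ v) (B *ᵥ u)]
  ring

theorem dotProduct_riccatiMap_mulVec_le (hR : R.PosDef) (hV : V.PosSemidef) (v : ι → ℝ)
    (u : κ → ℝ) : v ⬝ᵥ riccatiMap A B Q R V *ᵥ v ≤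
      (A *ᵥ v + B *ᵥ u) ⬝ᵥ V *ᵥ (A *ᵥ v + B *ᵥ u) + v ⬝ᵥ Q *ᵥ v + u ⬝ᵥ R *ᵥ u := by
  rw [riccatiMap_completeSquare hR hV]
  exact le_add_of_nonneg_right
    (dotProduct_mulVec_self_nonneg (posDef_transpose_mul_mul_add B hR hV).posSemidef _)

theorem dotProduct_riccatiMap_mulVec_eq (hR : R.PosDef) (hV : V.PosSemidef) (v : ι → ℝ) :
    v ⬝ᵥ riccatiMap A B Q R V *ᵥ v =
      (A *ᵥ v + B *ᵥ (-(riccatiGain A B R V *ᵥ v))) ⬝ᵥ V *ᵥ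
        (A *ᵥ v + B *ᵥ (-(riccatiGain A B R V *ᵥ v))) + v ⬝ᵥ Q *ᵥ v
        + (-(riccatiGain A B R V *ᵥ v)) ⬝ᵥ R *ᵥ (-(riccatiGain A B R V *ᵥ v)) := by
  rw [riccatiMap_completeSquare hR hV, neg_add_cancel, zero_dotProduct, add_zero]

theorem isHermitian_riccatiMap (hR : R.IsHermitian) (hQ : Q.IsHermitian) (hV : V.IsHermitian) :
    (riccatiMap A B Q R V).IsHermitian := by
  rw [IsHermitian, conjTranspose_eq_transpose_of_trivial, riccatiMap]
  simp only [transpose_sub, transpose_add, transpose_mul, transpose_transpose,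
    transpose_nonsing_inv, transpose_eq_of_isHermitian hV, transpose_eq_of_isHermitian hQ,
    transpose_eq_of_isHermitian hR, Matrix.mul_assoc]

theorem posSemidef_riccatiMap (hR : R.PosDef) (hQ : Q.PosSemidef) (hV : V.PosSemidef) :
    (riccatiMap A B Q R V).PosSemidef := by
  refine PosSemidef.of_dotProduct_mulVec_nonneg
    (isHermitian_riccatiMap hR.isHermitian hQ.isHermitian hV.isHermitian) fun v => ?_
  rw [star_trivial, dotProduct_riccatiMap_mulVec_eq hR hV]
  exact add_nonneg (add_nonneg (dotProduct_mulVec_self_nonneg hV _)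
    (dotProduct_mulVec_self_nonneg hQ _)) (dotProduct_mulVec_self_nonneg hR.posSemidef _)

theorem riccatiMap_mono (hR : R.PosDef) (hQ : Q.IsHermitian) (hV : V.PosSemidef) (hVW : V ≤ W) :
    riccatiMap A B Q R V ≤ riccatiMap A B Q R W := by
  have hW : W.PosSemidef := (hV.nonneg.trans hVW).posSemidef
  refine le_of_forall_dotProduct_mulVec_le
    (isHermitian_riccatiMap hR.isHermitian hQ hV.isHermitian)
    (isHermitian_riccatiMap hR.isHermitian hQ hW.isHermitian) fun v => ?_
  rw [dotProduct_riccatiMap_mulVec_eq hR hW]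
  refine (dotProduct_riccatiMap_mulVec_le hR hV v (-(riccatiGain A B R W *ᵥ v))).trans ?_
  gcongr
  exact dotProduct_mulVec_le_of_le hVW _

theorem dotProduct_mulVec_eq_zero_of_dotProduct_riccatiMap_mulVec_eq_zero (hR : R.PosDef)
    (hQ : Q.PosSemidef) (hV : V.PosSemidef) {v : ι → ℝ}
    (hv : v ⬝ᵥ riccatiMap A B Q R V *ᵥ v = 0) :
    v ⬝ᵥ Q *ᵥ v = 0 ∧ A *ᵥ v ⬝ᵥ V *ᵥ (A *ᵥ v) = 0 := by
  rw [dotProduct_riccatiMap_mulVec_eq hR hV] at hv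
  set u := -(riccatiGain A B R V *ᵥ v)
  have hstate := dotProduct_mulVec_self_nonneg hV (A *ᵥ v + B *ᵥ u)
  have hrun := dotProduct_mulVec_self_nonneg hQ v
  have hcontrol := dotProduct_mulVec_self_nonneg hR.posSemidef u
  have hu : u = 0 := by
    by_contra hne
    have := hR.dotProduct_mulVec_pos hne
    rw [star_trivial] at this
    linarith
  rw [hu, mulVec_zero, add_zero] at hv hstate
  simp only [zero_dotProduct, add_zero] at hv
  constructor <;> linarith

theorem continuousAt_riccatiMap (hR : R.PosDef) (hV : V.PosSemidef) :
    ContinuousAt (riccatiMap A B Q R) V := by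
  have hdet : (Bᵀ * V * B + R).det ≠ 0 := (posDef_transpose_mul_mul_add B hR hV).det_pos.ne'
  have hΛ : Continuous fun V : Matrix ι ι ℝ => Bᵀ * V * B + R := by fun_prop
  have hinv : ContinuousAt (fun V : Matrix ι ι ℝ => (Bᵀ * V * B + R)⁻¹) V := by
    simp only [Matrix.inv_def, Ring.inverse_eq_inv']
    exact (hΛ.matrix_det.continuousAt.inv₀ hdet).smul hΛ.matrix_adjugate.continuousAt
  have hpoly : Continuous fun VI : Matrix ι ι ℝ × Matrix κ κ ℝ =>
      Aᵀ * VI.1 * A + Q - (Bᵀ * VI.1 * A)ᵀ * VI.2 * (Bᵀ * VI.1 * A) := by fun_prop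
  exact ContinuousAt.comp (f := fun V => (V, (Bᵀ * V * B + R)⁻¹)) hpoly.continuousAt
    (continuousAt_id.prodMk hinv)

end RiccatiMap

section Lyapunov

variable {ι : Type*} [Fintype ι] [DecidableEq ι] {p : ℝ} {G : Matrix ι ι ℝ}

theorem exists_pow_mul_dotProduct_mulVec_self_le_half (hp : 0 ≤ p)
    (hG : ∀ v : ι → ℝ, Tendsto (fun k : ℕ => p ^ k * ((G ^ k) *ᵥ v ⬝ᵥ (G ^ k) *ᵥ v)) atTop (𝓝 0)) :
    ∃ k : ℕ, ∀ v : ι → ℝ, p ^ k * ((G ^ k) *ᵥ v ⬝ᵥ (G ^ k) *ᵥ v) ≤ 1 / 2 * (v ⬝ᵥ v) := by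
  have hcols (k : ℕ) : p ^ k * ∑ i, ∑ j, (G ^ k) i j ^ 2
      = ∑ j, p ^ k * ((G ^ k) *ᵥ Pi.single j 1 ⬝ᵥ (G ^ k) *ᵥ Pi.single j 1) := by
    rw [Finset.sum_comm, Finset.mul_sum]
    simp only [mulVec_single_one, dotProduct, col_apply, sq]
  have hsum : Tendsto (fun k : ℕ => p ^ k * ∑ i, ∑ j, (G ^ k) i j ^ 2) atTop (𝓝 0) := by
    simpa only [hcols, Finset.sum_const_zero] using
      tendsto_finsetSum Finset.univ fun j _ => hG (Pi.single j (1 : ℝ))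
  obtain ⟨k, hk⟩ := (hsum.eventually (ge_mem_nhds one_half_pos)).exists
  refine ⟨k, fun v => ?_⟩
  calc p ^ k * ((G ^ k) *ᵥ v ⬝ᵥ (G ^ k) *ᵥ v)
      ≤ p ^ k * ((∑ i, ∑ j, (G ^ k) i j ^ 2) * (v ⬝ᵥ v)) := by
        gcongr; exact dotProduct_mulVec_self_le _ _
    _ = (p ^ k * ∑ i, ∑ j, (G ^ k) i j ^ 2) * (v ⬝ᵥ v) := (mul_assoc _ _ _).symm
    _ ≤ 1 / 2 * (v ⬝ᵥ v) := mul_le_mul_of_nonneg_right hk (dotProduct_self_nonneg v)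

theorem exists_lyapunov_supersolution (hp : 0 ≤ p)
    (hG : ∀ v : ι → ℝ, Tendsto (fun k : ℕ => p ^ k * ((G ^ k) *ᵥ v ⬝ᵥ (G ^ k) *ᵥ v)) atTop (𝓝 0))
    (S : Matrix ι ι ℝ) :
    ∃ y : (ι → ℝ) → ℝ, (∀ v, 0 ≤ y v) ∧ ∀ v, v ⬝ᵥ S *ᵥ v + p * y (G *ᵥ v) ≤ y v := by
  obtain ⟨c, hc, hS⟩ := exists_dotProduct_mulVec_le S
  obtain ⟨k, hk⟩ := exists_pow_mul_dotProduct_mulVec_self_le_half hp hG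
  let a (v : ι → ℝ) (j : ℕ) : ℝ := p ^ j * ((G ^ j) *ᵥ v ⬝ᵥ (G ^ j) *ᵥ v)
  have hshift (v : ι → ℝ) (j : ℕ) : p * a (G *ᵥ v) j = a v (j + 1) := by
    simp only [a, mulVec_mulVec, ← pow_succ]
    ring
  have htelescope (v : ι → ℝ) : ∑ j ∈ Finset.range k, a v j
      - p * ∑ j ∈ Finset.range k, a (G *ᵥ v) j = v ⬝ᵥ v - a v k := by
    simp only [Finset.mul_sum, hshift, ← Finset.sum_sub_distrib, Finset.sum_range_sub' (a v)]
    simp [a]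
  refine ⟨fun v => 2 * c * ∑ j ∈ Finset.range k, a v j, fun v => ?_, fun v => ?_⟩
  · exact mul_nonneg (by positivity) (Finset.sum_nonneg fun j _ =>
      mul_nonneg (pow_nonneg hp j) (dotProduct_self_nonneg _))
  · have hdrop : c * (v ⬝ᵥ v) ≤ 2 * c * (v ⬝ᵥ v - a v k) := by
      nlinarith [hk v]
    rw [← htelescope] at hdrop
    linarith [hS v]

end Lyapunov

section ValueIteration

variable {ι κ : Type*} [Fintype ι] [Fintype κ] [DecidableEq κ] {A Q W : Matrix ι ι ℝ}
  {B : Matrix ι κ ℝ} {R : Matrix κ κ ℝ} {p : ℝ}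

/-- Value iteration from `0` for the discounted Riccati equation `X = riccatiMap A B Q R (W + p X)`.
With `p = 1`, `W = 0` this is the equation for `Z`, with terminal weight `(1 - p) Z + p X` the
one for `X`. -/
noncomputable def valueIteration (A : Matrix ι ι ℝ) (B : Matrix ι κ ℝ) (Q : Matrix ι ι ℝ)
    (R : Matrix κ κ ℝ) (W : Matrix ι ι ℝ) (p : ℝ) : ℕ → Matrix ι ι ℝ
  | 0 => 0
  | k + 1 => riccatiMap A B Q R (W + p • valueIteration A B Q R W p k)

theorem posSemidef_valueIteration (hR : R.PosDef) (hQ : Q.PosSemidef) (hW : W.PosSemidef)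
    (hp : 0 ≤ p) (k : ℕ) : (valueIteration A B Q R W p k).PosSemidef := by
  induction k with
  | zero => exact PosSemidef.zero
  | succ k ih => exact posSemidef_riccatiMap hR hQ (hW.add (ih.smul hp))

theorem monotone_valueIteration (hR : R.PosDef) (hQ : Q.PosSemidef) (hW : W.PosSemidef)
    (hp : 0 ≤ p) : Monotone (valueIteration A B Q R W p) := by
  have hpsd := posSemidef_valueIteration (A := A) (B := B) hR hQ hW hp
  refine monotone_nat_of_le_succ fun k => ?_
  induction k with
  | zero => exact (hpsd 1).nonneg
  | succ k ih =>
    refine riccatiMap_mono hR hQ.isHermitian (hW.add ((hpsd k).smul hp))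
      (add_le_add_right (le_iff.mpr ?_) W)
    rw [← smul_sub]
    exact (le_iff.mp ih).smul hp

theorem dotProduct_add_smul_mulVec (W Y : Matrix ι ι ℝ) (p : ℝ) (v : ι → ℝ) :
    v ⬝ᵥ (W + p • Y) *ᵥ v = v ⬝ᵥ W *ᵥ v + p * (v ⬝ᵥ Y *ᵥ v) := by
  rw [add_mulVec, smul_mulVec, dotProduct_add, dotProduct_smul, smul_eq_mul]

theorem dotProduct_valueIteration_mulVec_le (hR : R.PosDef) (hQ : Q.PosSemidef)
    (hW : W.PosSemidef) (hp : 0 ≤ p) (L : Matrix κ ι ℝ) {y : (ι → ℝ) → ℝ} (hy0 : ∀ v, 0 ≤ y v)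
    (hy : ∀ v, v ⬝ᵥ ((A - B * L)ᵀ * W * (A - B * L) + Q + Lᵀ * R * L) *ᵥ v
      + p * y ((A - B * L) *ᵥ v) ≤ y v) (k : ℕ) (v : ι → ℝ) :
    v ⬝ᵥ valueIteration A B Q R W p k *ᵥ v ≤ y v := by
  induction k generalizing v with
  | zero => simpa [valueIteration] using hy0 v
  | succ k ih =>
    have hpsd := posSemidef_valueIteration (A := A) (B := B) hR hQ hW hp k
    have hloop : A *ᵥ v + B *ᵥ (-(L *ᵥ v)) = (A - B * L) *ᵥ v := by
      rw [mulVec_neg, sub_mulVec, mulVec_mulVec, sub_eq_add_neg]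
    have hstep := dotProduct_riccatiMap_mulVec_le (A := A) (B := B) (Q := Q) hR
      (hW.add (hpsd.smul hp)) v (-(L *ᵥ v))
    rw [hloop, dotProduct_add_smul_mulVec, mulVec_neg, neg_dotProduct_neg] at hstep
    have hy := hy v
    simp only [add_mulVec, dotProduct_add, dotProduct_transpose_mul_mul_mulVec] at hy
    have hrec := mul_le_mul_of_nonneg_left (ih ((A - B * L) *ᵥ v)) hp
    exact hstep.trans (by linarith)

theorem exists_eq_riccatiMap [DecidableEq ι] (hR : R.PosDef) (hQ : Q.PosSemidef)
    (hW : W.PosSemidef) (hp : 0 ≤ p) (L : Matrix κ ι ℝ)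
    (hL : ∀ v : ι → ℝ, Tendsto (fun k : ℕ => p ^ k *
      (((A - B * L) ^ k) *ᵥ v ⬝ᵥ ((A - B * L) ^ k) *ᵥ v)) atTop (𝓝 0)) :
    ∃ X : Matrix ι ι ℝ, X.PosSemidef ∧ X = riccatiMap A B Q R (W + p • X) := by
  obtain ⟨y, hy0, hy⟩ := exists_lyapunov_supersolution hp hL
    ((A - B * L)ᵀ * W * (A - B * L) + Q + Lᵀ * R * L)
  have hpsd := posSemidef_valueIteration (A := A) (B := B) hR hQ hW hp
  have hmono := monotone_valueIteration (A := A) (B := B) hR hQ hW hp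
  obtain ⟨X, hX⟩ := exists_tendsto_of_forall_tendsto_dotProduct_mulVec
    (fun k => (hpsd k).isHermitian) fun v =>
      ⟨_, tendsto_atTop_ciSup (fun _ _ hjk => dotProduct_mulVec_le_of_le (hmono hjk) v)
        ⟨y v, Set.forall_mem_range.mpr
          fun k => dotProduct_valueIteration_mulVec_le hR hQ hW hp L hy0 hy k v⟩⟩
  have hXpsd : X.PosSemidef := posSemidef_of_tendsto hpsd hX
  have hcont : Tendsto (fun k => valueIteration A B Q R W p (k + 1)) atTop
      (𝓝 (riccatiMap A B Q R (W + p • X))) :=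
    (continuousAt_riccatiMap hR (hW.add (hXpsd.smul hp))).tendsto.comp
      ((hX.const_smul p).const_add W)
  exact ⟨X, hXpsd, tendsto_nhds_unique (hX.comp (tendsto_add_atTop_nat 1)) hcont⟩

end ValueIteration

section Observability

variable {n m : ℕ} {A : Matrix (Fin n) (Fin n) ℝ} {C : Matrix (Fin m) (Fin n) ℝ}

theorem Observable.exists_finite_horizon (h : Observable A C) :
    ∃ N : ℕ, ∀ v : Fin n → ℝ, (∀ k < N, C *ᵥ ((A ^ k) *ᵥ v) = 0) → v = 0 := by
  let U : ℕ →o (Submodule ℝ (Fin n → ℝ))ᵒᵈ :=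
    { toFun := fun N => OrderDual.toDual (⨅ k, ⨅ (_ : k < N), LinearMap.ker (C * A ^ k).mulVecLin)
      monotone' := fun a b hab => by
        rw [OrderDual.toDual_le_toDual]
        exact biInf_mono fun k hk => lt_of_lt_of_le hk hab }
  have mem_U (N : ℕ) (v : Fin n → ℝ) :
      v ∈ OrderDual.ofDual (U N) ↔ ∀ k < N, C *ᵥ ((A ^ k) *ᵥ v) = 0 := by
    simp [U, Submodule.mem_iInf, mulVec_mulVec]
  obtain ⟨N, hN⟩ := IsArtinian.monotone_stabilizes U
  refine ⟨N, fun v hv => h v fun k => ?_⟩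
  have hvk : v ∈ OrderDual.ofDual (U (max N (k + 1))) := by
    rw [← hN _ (le_max_left _ _)]
    exact (mem_U N v).mpr hv
  exact (mem_U _ v).mp hvk k (lt_max_of_lt_right k.lt_succ_self)

theorem Observable.exists_dotProduct_self_le_sum (h : Observable A C) :
    ∃ (N : ℕ) (c : ℝ), 0 ≤ c ∧ ∀ v : Fin n → ℝ, v ⬝ᵥ v ≤
      c * ∑ k ∈ Finset.range N, C *ᵥ ((A ^ k) *ᵥ v) ⬝ᵥ C *ᵥ ((A ^ k) *ᵥ v) := by
  obtain ⟨N, hN⟩ := h.exists_finite_horizon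
  let gramian := ∑ k ∈ Finset.range N, (C * A ^ k)ᵀ * (C * A ^ k)
  have hgramian (v : Fin n → ℝ) : v ⬝ᵥ gramian *ᵥ v
      = ∑ k ∈ Finset.range N, C *ᵥ ((A ^ k) *ᵥ v) ⬝ᵥ C *ᵥ ((A ^ k) *ᵥ v) := by
    simp only [gramian, sum_mulVec, dotProduct_sum, dotProduct_transpose_mul_self_mulVec,
      mulVec_mulVec]
  have hpos : gramian.PosDef := by
    refine PosDef.of_dotProduct_mulVec_pos ?_ fun v hv => ?_
    · rw [IsHermitian, conjTranspose_eq_transpose_of_trivial]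
      simp only [gramian, transpose_sum, transpose_mul, transpose_transpose]
    · rw [star_trivial, hgramian]
      refine (Finset.sum_nonneg fun k _ => dotProduct_self_nonneg _).lt_of_ne' fun hsum =>
        hv (hN v fun k hk => dotProduct_self_eq_zero.mp ?_)
      exact (Finset.sum_eq_zero_iff_of_nonneg fun k _ => dotProduct_self_nonneg _).mp hsum k
        (Finset.mem_range.mpr hk)
  obtain ⟨c, hc, hle⟩ := exists_dotProduct_self_le_of_posDef hpos
  exact ⟨N, c, hc, fun v => hgramian v ▸ hle v⟩

theorem posDef_of_eq_riccatiMap {κ : Type*} [Fintype κ] [DecidableEq κ]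
    {Q X : Matrix (Fin n) (Fin n) ℝ} {B : Matrix (Fin n) κ ℝ} {R : Matrix κ κ ℝ}
    (hR : R.PosDef) (hQ : Q.PosSemidef) (hX : X.PosSemidef) (hfix : X = riccatiMap A B Q R X)
    (hobs : Observable A (CFC.sqrt Q)) : X.PosDef := by
  have hstep {v : Fin n → ℝ} (hv : v ⬝ᵥ X *ᵥ v = 0) :
      v ⬝ᵥ Q *ᵥ v = 0 ∧ A *ᵥ v ⬝ᵥ X *ᵥ (A *ᵥ v) = 0 :=
    dotProduct_mulVec_eq_zero_of_dotProduct_riccatiMap_mulVec_eq_zero (B := B) hR hQ hX (hfix ▸ hv)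
  refine PosDef.of_dotProduct_mulVec_pos hX.isHermitian fun v hv => ?_
  refine (dotProduct_mulVec_self_nonneg hX v).lt_of_ne' fun hv0 => hv (hobs v fun k => ?_)
  have hk : (A ^ k) *ᵥ v ⬝ᵥ X *ᵥ ((A ^ k) *ᵥ v) = 0 := by
    induction k with
    | zero => simpa using hv0
    | succ k ih =>
      rw [pow_succ', ← mulVec_mulVec]
      exact (hstep ih).2
  rw [← dotProduct_self_eq_zero, dotProduct_sqrt_mulVec_self hQ]
  exact (hstep hk).1

end Observability

section RandomVectors

variable {Ω ι κ : Type*} [Fintype κ]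

theorem measurable_dotProduct {_ : MeasurableSpace Ω} {f g : Ω → κ → ℝ} (hf : Measurable f)
    (hg : Measurable g) : Measurable fun ω => f ω ⬝ᵥ g ω :=
  Finset.measurable_sum _ fun i _ => (hf.eval (a := i)).mul (hg.eval (a := i))

theorem measurable_mulVec {_ : MeasurableSpace Ω} {f : Ω → κ → ℝ} (hf : Measurable f)
    (S : Matrix ι κ ℝ) : Measurable fun ω => S *ᵥ f ω :=
  measurable_pi_lambda _ fun _ => measurable_dotProduct measurable_const hf

variable [Fintype ι] {m₀ : MeasurableSpace Ω} {μ : Measure Ω}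

theorem memLp_mulVec {p : ℝ≥0∞} {f : Ω → κ → ℝ} (hf : MemLp f p μ) (S : Matrix ι κ ℝ) :
    MemLp (fun ω => S *ᵥ f ω) p μ :=
  S.mulVecLin.toContinuousLinearMap.comp_memLp' hf

theorem integral_mulVec {f : Ω → κ → ℝ} (hf : Integrable f μ) (S : Matrix ι κ ℝ) :
    ∫ ω, S *ᵥ f ω ∂μ = S *ᵥ ∫ ω, f ω ∂μ :=
  S.mulVecLin.toContinuousLinearMap.integral_comp_comm hf

theorem memLp_apply {p : ℝ≥0∞} {f : Ω → ι → ℝ} (hf : MemLp f p μ) (i : ι) :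
    MemLp (fun ω => f ω i) p μ :=
  (ContinuousLinearMap.proj (R := ℝ) (φ := fun _ : ι => ℝ) i).comp_memLp' hf

theorem integrable_dotProduct {f g : Ω → ι → ℝ} (hf : MemLp f 2 μ) (hg : MemLp g 2 μ) :
    Integrable (fun ω => f ω ⬝ᵥ g ω) μ :=
  integrable_finsetSum _ fun i _ => (memLp_apply hf i).integrable_mul (memLp_apply hg i)

theorem integrable_dotProduct_mulVec {f : Ω → ι → ℝ} {g : Ω → κ → ℝ} (hf : MemLp f 2 μ)
    (hg : MemLp g 2 μ) (S : Matrix ι κ ℝ) : Integrable (fun ω => f ω ⬝ᵥ S *ᵥ g ω) μ :=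
  integrable_dotProduct hf (memLp_mulVec hg S)

theorem integral_dotProduct_mulVec_self_nonneg {S : Matrix ι ι ℝ} (hS : S.PosSemidef)
    (f : Ω → ι → ℝ) : 0 ≤ ∫ ω, f ω ⬝ᵥ S *ᵥ f ω ∂μ :=
  integral_nonneg fun ω => dotProduct_mulVec_self_nonneg hS (f ω)

variable {m : MeasurableSpace Ω}

theorem condExp_mulVec {f : Ω → κ → ℝ} (hf : Integrable f μ) (S : Matrix ι κ ℝ) :
    μ[fun ω => S *ᵥ f ω | m] =ᵐ[μ] fun ω => S *ᵥ (μ[f | m]) ω :=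
  (S.mulVecLin.toContinuousLinearMap.comp_condExp_comm hf).symm

theorem condExp_apply {f : Ω → ι → ℝ} (hf : Integrable f μ) (i : ι) :
    μ[fun ω => f ω i | m] =ᵐ[μ] fun ω => (μ[f | m]) ω i :=
  ((ContinuousLinearMap.proj (R := ℝ) (φ := fun _ : ι => ℝ) i).comp_condExp_comm hf).symm

theorem condExp_mulVec_eq_zero {d : Ω → κ → ℝ} (hd : Integrable d μ) (hd0 : μ[d | m] =ᵐ[μ] 0)
    (S : Matrix ι κ ℝ) : μ[fun ω => S *ᵥ d ω | m] =ᵐ[μ] 0 := by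
  filter_upwards [condExp_mulVec (m := m) hd S, hd0] with ω hcomm hzero
  simp [hcomm, hzero]

variable [IsFiniteMeasure μ]

theorem condExp_sub_condExp_eq_zero {E : Type*} [NormedAddCommGroup E] [NormedSpace ℝ E]
    [CompleteSpace E] (hm : m ≤ m₀) {f : Ω → E} (hf : Integrable f μ) :
    μ[fun ω => f ω - (μ[f | m]) ω | m] =ᵐ[μ] 0 := by
  have hsub := condExp_sub hf (integrable_condExp (μ := μ) (m := m) (f := f)) m
  rwa [condExp_of_stronglyMeasurable hm stronglyMeasurable_condExp integrable_condExp,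
    sub_self] at hsub

theorem integral_dotProduct_eq_zero_of_condExp_eq_zero (hm : m ≤ m₀) {g d : Ω → ι → ℝ}
    (hgm : StronglyMeasurable[m] g) (hg : MemLp g 2 μ) (hd : MemLp d 2 μ)
    (hd0 : μ[d | m] =ᵐ[μ] 0) : ∫ ω, g ω ⬝ᵥ d ω ∂μ = 0 := by
  have hint (i : ι) : Integrable (fun ω => g ω i * d ω i) μ :=
    (memLp_apply hg i).integrable_mul (memLp_apply hd i)
  simp only [dotProduct]
  rw [integral_finsetSum _ fun i _ => hint i]
  refine Finset.sum_eq_zero fun i _ => ?_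
  have hpull := condExp_mul_of_stronglyMeasurable_left
    ((continuous_apply i).comp_stronglyMeasurable hgm) (hint i)
    ((memLp_apply hd i).integrable one_le_two)
  rw [← integral_condExp hm]
  refine integral_eq_zero_of_ae (hpull.trans ?_)
  filter_upwards [condExp_apply (m := m) (hd.integrable one_le_two) i, hd0] with ω hcoord hzero
  simp [hcoord, hzero]

theorem integral_dotProduct_mulVec_eq_zero_right (hm : m ≤ m₀) {g d : Ω → ι → ℝ}
    (hgm : StronglyMeasurable[m] g) (hg : MemLp g 2 μ) (hd : MemLp d 2 μ)
    (hd0 : μ[d | m] =ᵐ[μ] 0) (S : Matrix ι ι ℝ) : ∫ ω, g ω ⬝ᵥ S *ᵥ d ω ∂μ = 0 :=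
  integral_dotProduct_eq_zero_of_condExp_eq_zero hm hgm hg (memLp_mulVec hd S)
    (condExp_mulVec_eq_zero (hd.integrable one_le_two) hd0 S)

theorem integral_dotProduct_mulVec_eq_zero_left (hm : m ≤ m₀) {g d : Ω → ι → ℝ}
    (hgm : StronglyMeasurable[m] g) (hg : MemLp g 2 μ) (hd : MemLp d 2 μ)
    (hd0 : μ[d | m] =ᵐ[μ] 0) (S : Matrix ι ι ℝ) : ∫ ω, d ω ⬝ᵥ S *ᵥ g ω ∂μ = 0 := by
  simp_rw [dotProduct_comm (d _)]
  exact integral_dotProduct_eq_zero_of_condExp_eq_zero hm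
    (S.mulVecLin.toContinuousLinearMap.continuous.comp_stronglyMeasurable hgm)
    (memLp_mulVec hg S) hd hd0

theorem integral_dotProduct_mulVec_condExp (hm : m ≤ m₀) {f : Ω → ι → ℝ} (hf : MemLp f 2 μ)
    (S : Matrix ι ι ℝ) : ∫ ω, f ω ⬝ᵥ S *ᵥ (μ[f | m]) ω ∂μ
      = ∫ ω, (μ[f | m]) ω ⬝ᵥ S *ᵥ (μ[f | m]) ω ∂μ := by
  have hce : MemLp (μ[f | m]) 2 μ := hf.condExp one_le_two
  rw [← sub_eq_zero, ← integral_sub (integrable_dotProduct_mulVec hf hce S)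
    (integrable_dotProduct_mulVec hce hce S)]
  simp_rw [← sub_dotProduct]
  exact integral_dotProduct_mulVec_eq_zero_left hm stronglyMeasurable_condExp hce (hf.sub hce)
    (condExp_sub_condExp_eq_zero hm (hf.integrable one_le_two)) S

theorem integral_dotProduct_mulVec_residual (hm : m ≤ m₀) {f : Ω → ι → ℝ} (hf : MemLp f 2 μ)
    (S : Matrix ι ι ℝ) : ∫ ω, f ω ⬝ᵥ S *ᵥ (f ω - (μ[f | m]) ω) ∂μ
      = ∫ ω, (f ω - (μ[f | m]) ω) ⬝ᵥ S *ᵥ (f ω - (μ[f | m]) ω) ∂μ := by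
  have hce : MemLp (μ[f | m]) 2 μ := hf.condExp one_le_two
  have hres : MemLp (fun ω => f ω - (μ[f | m]) ω) 2 μ := hf.sub hce
  rw [← sub_eq_zero, ← integral_sub (integrable_dotProduct_mulVec hf hres S)
    (integrable_dotProduct_mulVec hres hres S)]
  simp_rw [← sub_dotProduct, sub_sub_cancel]
  exact integral_dotProduct_mulVec_eq_zero_right hm stronglyMeasurable_condExp hce hres
    (condExp_sub_condExp_eq_zero hm (hf.integrable one_le_two)) S

theorem integral_dotProduct_mulVec_eq_condExp_add_residual (hm : m ≤ m₀) {f : Ω → ι → ℝ}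
    (hf : MemLp f 2 μ) (S : Matrix ι ι ℝ) :
    ∫ ω, f ω ⬝ᵥ S *ᵥ f ω ∂μ = ∫ ω, (μ[f | m]) ω ⬝ᵥ S *ᵥ (μ[f | m]) ω ∂μ
      + ∫ ω, (f ω - (μ[f | m]) ω) ⬝ᵥ S *ᵥ (f ω - (μ[f | m]) ω) ∂μ := by
  have hce : MemLp (μ[f | m]) 2 μ := hf.condExp one_le_two
  have hres : MemLp (fun ω => f ω - (μ[f | m]) ω) 2 μ := hf.sub hce
  rw [← integral_dotProduct_mulVec_condExp hm hf, ← integral_dotProduct_mulVec_residual hm hf,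
    ← integral_add (integrable_dotProduct_mulVec hf hce S)
      (integrable_dotProduct_mulVec hf hres S)]
  simp_rw [← dotProduct_add, ← mulVec_add, add_sub_cancel]

end RandomVectors

section ErasureChannel

variable {Ω : Type*} {n : ℕ} {b : Ω → Bool} {f : Ω → Fin n → ℝ}

theorem measurable_received {_ : MeasurableSpace Ω} (hb : Measurable b) (hf : Measurable f) :
    Measurable fun ω => received (b ω) (f ω) :=
  hb.prodMk (Measurable.ite (hb (MeasurableSet.singleton true)) hf measurable_const)

theorem measurable_ite_of_measurable_received {m : MeasurableSpace Ω} {e : Ω → Fin n → ℝ}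
    (hr : Measurable fun ω => received (b ω) (f ω)) (he : Measurable e) :
    Measurable fun ω => if b ω then f ω else e ω := by
  have hb : Measurable b := measurable_fst.comp hr
  have hf : Measurable fun ω => if b ω then f ω else 0 := measurable_snd.comp hr
  have hmask : (fun ω => if b ω then f ω else e ω)
      = fun ω => if b ω then (if b ω then f ω else 0) else e ω := by
    ext ω; cases b ω <;> simp
  rw [hmask]
  exact Measurable.ite (hb (MeasurableSet.singleton true)) hf he

theorem exists_inter_eq_of_measurableSet_sup_received {m : MeasurableSpace Ω} {s : Set Ω}
    (hs : MeasurableSet[m ⊔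
      MeasurableSpace.comap (fun ω => received (b ω) (f ω)) inferInstance] s) :
    ∃ t, MeasurableSet[m] t ∧ s ∩ {ω | b ω = false} = t ∩ {ω | b ω = false} := by
  let traceSigma : MeasurableSpace Ω :=
    { MeasurableSet' := fun s =>
        ∃ t, MeasurableSet[m] t ∧ s ∩ {ω | b ω = false} = t ∩ {ω | b ω = false}
      measurableSet_empty := ⟨∅, MeasurableSet.empty, rfl⟩
      measurableSet_compl := by
        rintro s ⟨t, ht, hst⟩
        refine ⟨tᶜ, ht.compl, ?_⟩
        rw [← Set.sdiff_eq_compl_inter, ← Set.sdiff_eq_compl_inter, ← Set.sdiff_inter_self_eq_sdiff,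
          hst, Set.sdiff_inter_self_eq_sdiff]
      measurableSet_iUnion := by
        intro u hu
        choose t ht hut using hu
        exact ⟨⋃ i, t i, MeasurableSet.iUnion ht, by simp_rw [Set.iUnion_inter, hut]⟩ }
  refine (sup_le (fun t ht => ⟨t, ht, rfl⟩) ?_ : _ ≤ traceSigma) s hs
  rintro _ ⟨u, -, rfl⟩
  refine ⟨{_ω | ((false, 0) : Bool × (Fin n → ℝ)) ∈ u}, MeasurableSet.const _, ?_⟩
  ext ω
  simp +contextual [received]

variable {m H m₀ : MeasurableSpace Ω} {μ : Measure Ω}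

theorem setIntegral_inter_eq_smul_of_indep {E : Type*} [NormedAddCommGroup E] [NormedSpace ℝ E]
    [MeasurableSpace E] [BorelSpace E] [SecondCountableTopology E] (hH : H ≤ m₀)
    (hb : Measurable b) (hind : Indep H (MeasurableSpace.comap b inferInstance) μ) {g : Ω → E}
    (hg : Measurable[H] g) {t : Set Ω} (ht : MeasurableSet[H] t) (c : Bool) :
    ∫ ω in t ∩ {ω | b ω = c}, g ω ∂μ = μ.real {ω | b ω = c} • ∫ ω in t, g ω ∂μ := by
  have hgt : Measurable[H] (t.indicator g) := hg.indicator ht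
  rw [Set.inter_comm, ← integral_indicator (hH t ht), ← setIntegral_indicator (hH t ht)]
  exact Indep.setIntegral_eq_smul (f := id) hb.comap_le
    (indep_of_indep_of_le_right hind.symm hgt.comap_le) (hgt.mono hH le_rfl).aemeasurable
    ⟨{c}, trivial, rfl⟩ aestronglyMeasurable_id

theorem integrable_ite {E : Type*} [NormedAddCommGroup E] {g h : Ω → E} (hb : Measurable b)
    (hg : Integrable g μ) (hh : Integrable h μ) :
    Integrable (fun ω => if b ω then g ω else h ω) μ := by
  refine Integrable.congr ((hg.indicator (hb (MeasurableSet.singleton true))).add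
    (hh.indicator (hb (MeasurableSet.singleton false)))) (ae_of_all _ fun ω => ?_)
  cases hω : b ω <;> simp [Set.indicator, hω]

theorem setIntegral_ite {E : Type*} [NormedAddCommGroup E] [NormedSpace ℝ E] {g h : Ω → E}
    (hb : Measurable b) (hg : Integrable g μ) (hh : Integrable h μ) {s : Set Ω}
    (hs : MeasurableSet s) :
    ∫ ω in s, (if b ω then g ω else h ω) ∂μ
      = ∫ ω in s ∩ {ω | b ω = true}, g ω ∂μ + ∫ ω in s ∩ {ω | b ω = false}, h ω ∂μ := by
  have hmeas (c : Bool) : MeasurableSet {ω | b ω = c} := hb (MeasurableSet.singleton c)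
  have hcompl : {ω | b ω = true}ᶜ = {ω | b ω = false} := by ext; simp
  rw [← integral_inter_add_sdiff (hmeas true) (integrable_ite hb hg hh).integrableOn, Set.sdiff_eq,
    hcompl]
  congr 1 <;>
    exact setIntegral_congr_fun (hs.inter (hmeas _)) fun ω hω => by simp [Set.mem_ofPred.mp hω.2]

variable [IsProbabilityMeasure μ]

theorem condExp_sup_received (hmH : m ≤ H) (hH : H ≤ m₀) (hb : Measurable b)
    (hind : Indep H (MeasurableSpace.comap b inferInstance) μ) (hfH : Measurable[H] f)
    (hf : Integrable f μ) :
    μ[f | m ⊔ MeasurableSpace.comap (fun ω => received (b ω) (f ω)) inferInstance]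
      =ᵐ[μ] fun ω => if b ω then f ω else (μ[f | m]) ω := by
  set m' := m ⊔ MeasurableSpace.comap (fun ω => received (b ω) (f ω)) inferInstance
  have hle : m' ≤ m₀ :=
    sup_le (hmH.trans hH) (measurable_received hb (hfH.mono hH le_rfl)).comap_le
  have hce : Measurable[m] (μ[f | m]) := stronglyMeasurable_condExp.measurable
  have hmeas : Measurable[m'] fun ω => if b ω then f ω else (μ[f | m]) ω :=
    measurable_ite_of_measurable_received ((comap_measurable _).mono le_sup_right le_rfl)
      (hce.mono le_sup_left le_rfl)
  refine (ae_eq_condExp_of_forall_setIntegral_eq hle hf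
    (fun _ _ _ => (integrable_ite hb hf integrable_condExp).integrableOn) (fun s hs _ => ?_)
    hmeas.stronglyMeasurable.aestronglyMeasurable).symm
  obtain ⟨t, ht, hst⟩ := exists_inter_eq_of_measurableSet_sup_received hs
  have hloss : ∫ ω in s ∩ {ω | b ω = false}, (μ[f | m]) ω ∂μ
      = ∫ ω in s ∩ {ω | b ω = false}, f ω ∂μ := by
    rw [hst, setIntegral_inter_eq_smul_of_indep hH hb hind (hce.mono hmH le_rfl) (hmH t ht),
      setIntegral_inter_eq_smul_of_indep hH hb hind hfH (hmH t ht),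
      setIntegral_condExp (hmH.trans hH) hf ht]
  rw [setIntegral_ite hb hf integrable_condExp (hle s hs), hloss,
    ← setIntegral_ite hb hf hf (hle s hs)]
  simp only [ite_self]

theorem integral_ite_of_indep (hH : H ≤ m₀) (hb : Measurable b)
    (hind : Indep H (MeasurableSpace.comap b inferInstance) μ) {p : ℝ} (hp : 0 ≤ p)
    (hbp : μ {ω | b ω = false} = ENNReal.ofReal p) {g h : Ω → ℝ} (hgH : Measurable[H] g)
    (hg : Integrable g μ) (hhH : Measurable[H] h) (hh : Integrable h μ) :
    ∫ ω, (if b ω then g ω else h ω) ∂μ = (1 - p) * ∫ ω, g ω ∂μ + p * ∫ ω, h ω ∂μ := by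
  have hloss : μ.real {ω | b ω = false} = p := by
    rw [measureReal_def, hbp, ENNReal.toReal_ofReal hp]
  have harrival : μ.real {ω | b ω = true} = 1 - p := by
    have hcompl : {ω | b ω = false}ᶜ = {ω | b ω = true} := by ext; simp
    have hmeas : MeasurableSet {ω | b ω = false} := hb (MeasurableSet.singleton false)
    rw [← hloss, ← hcompl, probReal_compl_eq_one_sub hmeas]
  have hsplit := setIntegral_ite hb hg hh MeasurableSet.univ
  rwa [setIntegral_inter_eq_smul_of_indep hH hb hind hgH MeasurableSet.univ,
    setIntegral_inter_eq_smul_of_indep hH hb hind hhH MeasurableSet.univ, hloss, harrival,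
    setIntegral_univ, setIntegral_univ, setIntegral_univ] at hsplit

theorem integral_dotProduct_mulVec_sup_received (hmH : m ≤ H) (hH : H ≤ m₀) (hb : Measurable b)
    (hind : Indep H (MeasurableSpace.comap b inferInstance) μ) (hfH : Measurable[H] f)
    (hf : MemLp f 2 μ) {p : ℝ} (hp : 0 ≤ p) (hbp : μ {ω | b ω = false} = ENNReal.ofReal p)
    (Z X : Matrix (Fin n) (Fin n) ℝ) {g : Ω → Fin n → ℝ}
    (hg : g =ᵐ[μ] μ[f | m ⊔ MeasurableSpace.comap (fun ω => received (b ω) (f ω)) inferInstance]) :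
    ∫ ω, (g ω ⬝ᵥ Z *ᵥ g ω + (f ω - g ω) ⬝ᵥ X *ᵥ (f ω - g ω)) ∂μ
      = ∫ ω, (μ[f | m]) ω ⬝ᵥ Z *ᵥ (μ[f | m]) ω ∂μ
        + ∫ ω, (f ω - (μ[f | m]) ω) ⬝ᵥ ((1 - p) • Z + p • X) *ᵥ (f ω - (μ[f | m]) ω) ∂μ := by
  set e := μ[f | m]
  have heL : MemLp e 2 μ := hf.condExp one_le_two
  have hdL : MemLp (fun ω => f ω - e ω) 2 μ := hf.sub heL
  have heH : Measurable[H] e := stronglyMeasurable_condExp.measurable.mono hmH le_rfl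
  have hdH : Measurable[H] fun ω => f ω - e ω := hfH.sub heH
  have hquad {h : Ω → Fin n → ℝ} (hh : Measurable[H] h) (S : Matrix (Fin n) (Fin n) ℝ) :
      Measurable[H] fun ω => h ω ⬝ᵥ S *ᵥ h ω := measurable_dotProduct hh (measurable_mulVec hh S)
  have heZ := integrable_dotProduct_mulVec heL heL Z
  have hdS := integrable_dotProduct_mulVec hdL hdL
  have hupdate : (fun ω => g ω ⬝ᵥ Z *ᵥ g ω + (f ω - g ω) ⬝ᵥ X *ᵥ (f ω - g ω)) =ᵐ[μ]
      fun ω => if b ω then f ω ⬝ᵥ Z *ᵥ f ω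
        else e ω ⬝ᵥ Z *ᵥ e ω + (f ω - e ω) ⬝ᵥ X *ᵥ (f ω - e ω) := by
    filter_upwards [hg.trans (condExp_sup_received hmH hH hb hind hfH (hf.integrable one_le_two))]
      with ω hω
    rw [hω]
    cases b ω <;> simp [e]
  rw [integral_congr_ae hupdate, integral_ite_of_indep hH hb hind hp hbp (hquad hfH Z)
    (integrable_dotProduct_mulVec hf hf Z) ((hquad heH Z).fun_add (hquad hdH X))
    (heZ.fun_add (hdS X)), integral_add heZ (hdS X),
    integral_dotProduct_mulVec_eq_condExp_add_residual (hmH.trans hH) hf Z]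
  simp only [add_mulVec, smul_mulVec, dotProduct_add, dotProduct_smul, smul_eq_mul]
  rw [integral_add ((hdS Z).const_mul _) ((hdS X).const_mul _), integral_const_mul,
    integral_const_mul]
  ring

end ErasureChannel

section MeanSquare

variable {Ω : Type*} [MeasurableSpace Ω] {μ : Measure Ω} {ι κ J : Type*} [Fintype ι] [Fintype κ]

/-- Convergence to zero in mean square of a sequence of random vectors. The second moment is a lower
integral, so that the notion makes sense before square-integrability is known. -/
def MSTendstoZero (μ : Measure Ω) (f : ℕ → Ω → ι → ℝ) : Prop :=
  Tendsto (fun k => ∫⁻ ω, ENNReal.ofReal (f k ω ⬝ᵥ f k ω) ∂μ) atTop (𝓝 0)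

namespace MSTendstoZero

theorem of_lintegral_le {f : ℕ → Ω → ι → ℝ} {u : ℕ → ℝ≥0∞} (hu : Tendsto u atTop (𝓝 0)) {c : ℝ}
    (h : ∀ k, ∫⁻ ω, ENNReal.ofReal (f k ω ⬝ᵥ f k ω) ∂μ ≤ ENNReal.ofReal c * u k) :
    MSTendstoZero μ f := by
  have hcu := ENNReal.Tendsto.const_mul (a := ENNReal.ofReal c) hu (Or.inr ENNReal.ofReal_ne_top)
  rw [mul_zero] at hcu
  exact tendsto_of_tendsto_of_tendsto_of_le_of_le tendsto_const_nhds hcu (fun _ => zero_le) h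

theorem of_le {f : ℕ → Ω → ι → ℝ} {g : ℕ → Ω → κ → ℝ} (hf : MSTendstoZero μ f) {c : ℝ}
    (h : ∀ k ω, g k ω ⬝ᵥ g k ω ≤ c * (f k ω ⬝ᵥ f k ω)) : MSTendstoZero μ g := by
  refine of_lintegral_le (c := c) hf fun k => ?_
  rw [← lintegral_const_mul' _ _ ENNReal.ofReal_ne_top]
  refine lintegral_mono fun ω => ?_
  rw [← ENNReal.ofReal_mul' (dotProduct_self_nonneg _)]
  exact ENNReal.ofReal_le_ofReal (h k ω)

theorem of_le_sum {s : Finset J} {f : J → ℕ → Ω → ι → ℝ} {g : ℕ → Ω → κ → ℝ}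
    (hfm : ∀ j k, Measurable (f j k)) (hf : ∀ j ∈ s, MSTendstoZero μ (f j)) {c : ℝ}
    (h : ∀ k ω, g k ω ⬝ᵥ g k ω ≤ c * ∑ j ∈ s, f j k ω ⬝ᵥ f j k ω) : MSTendstoZero μ g := by
  have hsum := tendsto_finsetSum s hf
  rw [Finset.sum_const_zero] at hsum
  refine of_lintegral_le (c := c) hsum fun k => ?_
  rw [← lintegral_finsetSum _ fun j _ => (measurable_dotProduct (hfm j k) (hfm j k)).ennreal_ofReal,
    ← lintegral_const_mul' _ _ ENNReal.ofReal_ne_top]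
  refine lintegral_mono fun ω => ?_
  dsimp only
  rw [← ENNReal.ofReal_sum_of_nonneg fun j _ => dotProduct_self_nonneg _,
    ← ENNReal.ofReal_mul' (Finset.sum_nonneg fun j _ => dotProduct_self_nonneg _)]
  exact ENNReal.ofReal_le_ofReal (h k ω)

theorem mulVec {f : ℕ → Ω → κ → ℝ} (hf : MSTendstoZero μ f) (S : Matrix ι κ ℝ) :
    MSTendstoZero μ fun k ω => S *ᵥ f k ω :=
  hf.of_le fun k ω => dotProduct_mulVec_self_le S (f k ω)

theorem neg {f : ℕ → Ω → κ → ℝ} (hf : MSTendstoZero μ f) : MSTendstoZero μ fun k ω => -f k ω :=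
  hf.of_le (c := 1) fun k ω => by rw [neg_dotProduct_neg, one_mul]

theorem add {f g : ℕ → Ω → ι → ℝ} (hf : MSTendstoZero μ f) (hg : MSTendstoZero μ g)
    (hfm : ∀ k, Measurable (f k)) (hgm : ∀ k, Measurable (g k)) :
    MSTendstoZero μ fun k ω => f k ω + g k ω := by
  refine of_le_sum (s := Finset.univ) (f := fun b : Bool => if b then f else g) (c := 2)
    (by simp [hfm, hgm]) (by simp [hf, hg]) fun k ω => ?_
  have hparallelogram := dotProduct_self_nonneg (f k ω - g k ω)
  simp only [Fintype.sum_bool, if_true, Bool.false_eq_true, if_false, dotProduct_sub,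
    sub_dotProduct, dotProduct_add, add_dotProduct, dotProduct_comm (g k ω) (f k ω)] at *
  linarith

theorem comp_add {f : ℕ → Ω → ι → ℝ} (hf : MSTendstoZero μ f) (j : ℕ) :
    MSTendstoZero μ fun k => f (k + j) :=
  hf.comp (tendsto_add_atTop_nat j)

end MSTendstoZero

theorem lintegral_dotProduct_self_eq {f : Ω → ι → ℝ} (hf : MemLp f 2 μ) :
    ∫⁻ ω, ENNReal.ofReal (f ω ⬝ᵥ f ω) ∂μ = ENNReal.ofReal (∫ ω, f ω ⬝ᵥ f ω ∂μ) :=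
  (ofReal_integral_eq_lintegral_ofReal (integrable_dotProduct hf hf)
    (ae_of_all _ fun _ => dotProduct_self_nonneg _)).symm

theorem MSTendstoZero.tendsto_integral {f : ℕ → Ω → ι → ℝ} (hf : MSTendstoZero μ f)
    (hL : ∀ k, MemLp (f k) 2 μ) : Tendsto (fun k => ∫ ω, f k ω ⬝ᵥ f k ω ∂μ) atTop (𝓝 0) := by
  refine ((ENNReal.tendsto_toReal ENNReal.zero_ne_top).comp hf).congr fun k => ?_
  rw [Function.comp_apply, lintegral_dotProduct_self_eq (hL k),
    ENNReal.toReal_ofReal (integral_nonneg fun _ => dotProduct_self_nonneg _)]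

theorem sq_norm_le_dotProduct_self (v : ι → ℝ) : ‖v‖ ^ 2 ≤ v ⬝ᵥ v := by
  rw [← Real.le_sqrt (norm_nonneg v) (dotProduct_self_nonneg v)]
  refine (pi_norm_le_iff_of_nonneg (Real.sqrt_nonneg _)).mpr fun i => Real.le_sqrt_of_sq_le ?_
  rw [Real.norm_eq_abs, sq_abs, sq]
  exact Finset.single_le_sum (f := fun i => v i * v i) (fun i _ => mul_self_nonneg (v i))
    (Finset.mem_univ i)

theorem memLp_two_of_lintegral_dotProduct_self_ne_top {f : Ω → ι → ℝ} (hf : Measurable f)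
    (h : ∫⁻ ω, ENNReal.ofReal (f ω ⬝ᵥ f ω) ∂μ ≠ ⊤) : MemLp f 2 μ := by
  have hint : Integrable (fun ω => f ω ⬝ᵥ f ω) μ :=
    (lintegral_ofReal_ne_top_iff_integrable
      (measurable_dotProduct hf hf).aestronglyMeasurable
      (ae_of_all _ fun ω => dotProduct_self_nonneg _)).mp h
  rw [memLp_two_iff_integrable_sq_norm hf.aestronglyMeasurable]
  refine hint.mono' (hf.norm.pow_const 2).aestronglyMeasurable (ae_of_all _ fun ω => ?_)
  rw [Real.norm_of_nonneg (by positivity)]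
  exact sq_norm_le_dotProduct_self (f ω)

variable {n m : ℕ} {A : Matrix (Fin n) (Fin n) ℝ} {C : Matrix (Fin m) (Fin n) ℝ}
  {x w : ℕ → Ω → Fin n → ℝ}

theorem MSTendstoZero.pow_mulVec_sub (hxw : ∀ k ω, x (k + 1) ω = A *ᵥ x k ω + w k ω)
    (hxm : ∀ k, Measurable (x k)) (hwm : ∀ k, Measurable (w k)) (hw : MSTendstoZero μ w) (j : ℕ) :
    MSTendstoZero μ fun k ω => (A ^ j) *ᵥ x k ω - x (k + j) ω := by
  induction j with
  | zero => simp [MSTendstoZero]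
  | succ j ih =>
    have hstep := (ih.mulVec A).add (hw.comp_add j).neg
      (fun k => measurable_mulVec ((measurable_mulVec (hxm k) _).sub (hxm (k + j))) A)
      fun k => (hwm (k + j)).neg
    refine hstep.of_le (c := 1) fun k ω => le_of_eq ?_
    rw [one_mul, ← add_assoc, hxw, pow_succ', ← mulVec_mulVec, mulVec_sub]
    congr 1 <;> abel

theorem MSTendstoZero.of_observable (h : Observable A C)
    (hxw : ∀ k ω, x (k + 1) ω = A *ᵥ x k ω + w k ω) (hxm : ∀ k, Measurable (x k))
    (hwm : ∀ k, Measurable (w k)) (hw : MSTendstoZero μ w)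
    (hC : MSTendstoZero μ fun k ω => C *ᵥ x k ω) : MSTendstoZero μ x := by
  have hfree (j : ℕ) : MSTendstoZero μ fun k ω => C *ᵥ ((A ^ j) *ᵥ x k ω) := by
    have hadd := ((pow_mulVec_sub hxw hxm hwm hw j).mulVec C).add (hC.comp_add j)
      (fun k => measurable_mulVec ((measurable_mulVec (hxm k) _).sub (hxm (k + j))) C)
      fun k => measurable_mulVec (hxm (k + j)) C
    simpa only [mulVec_sub, sub_add_cancel] using hadd
  obtain ⟨N, c, -, hle⟩ := h.exists_dotProduct_self_le_sum
  exact of_le_sum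
    (fun j k => measurable_mulVec (measurable_mulVec (hxm k) (A ^ j)) C)
    (fun j _ => hfree j) fun k ω => hle (x k ω)

end MeanSquare

section ChannelHistory

variable {Ω : Type*}

theorem sup_eq_generateFrom_image2_inter (m₁ m₂ : MeasurableSpace Ω) :
    m₁ ⊔ m₂ = MeasurableSpace.generateFrom
      (Set.image2 (· ∩ ·) {s | MeasurableSet[m₁] s} {s | MeasurableSet[m₂] s}) := by
  refine le_antisymm (sup_le (fun s hs => ?_) fun s hs => ?_) (MeasurableSpace.generateFrom_le ?_)
  · exact MeasurableSpace.measurableSet_generateFrom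
      ⟨s, hs, Set.univ, @MeasurableSet.univ _ m₂, Set.inter_univ s⟩
  · exact MeasurableSpace.measurableSet_generateFrom
      ⟨Set.univ, @MeasurableSet.univ _ m₁, s, hs, Set.univ_inter s⟩
  · rintro _ ⟨s, hs, t, ht, rfl⟩
    exact (le_sup_left (a := m₁) (b := m₂) s hs).inter (le_sup_right (a := m₁) (b := m₂) t ht)

theorem indep_sup_left {m₁ m₂ m₃ m₀ : MeasurableSpace Ω} {μ : Measure Ω} [IsProbabilityMeasure μ]
    (hm₁ : m₁ ≤ m₀) (hm₂ : m₂ ≤ m₀) (hm₃ : m₃ ≤ m₀) (hindep : Indep m₁ (m₂ ⊔ m₃) μ)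
    (hindep' : Indep m₂ m₃ μ) : Indep (m₁ ⊔ m₂) m₃ μ := by
  refine IndepSets.indep (sup_le hm₁ hm₂) hm₃ ?_ (@MeasurableSpace.isPiSystem_measurableSet _ m₃)
    (sup_eq_generateFrom_image2_inter m₁ m₂)
    (@MeasurableSpace.generateFrom_measurableSet _ m₃).symm ?_
  · rintro _ ⟨s, hs, t, ht, rfl⟩ _ ⟨s', hs', t', ht', rfl⟩ -
    exact ⟨s ∩ s', MeasurableSet.inter hs hs', t ∩ t', MeasurableSet.inter ht ht',
      (Set.inter_inter_inter_comm s t s' t').symm⟩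
  · rw [IndepSets_iff]
    rintro _ u ⟨s, hs, t, ht, rfl⟩ hu
    rw [Indep_iff] at hindep hindep'
    have ht' := le_sup_left (a := m₂) (b := m₃) t ht
    have hu' := le_sup_right (a := m₂) (b := m₃) u hu
    rw [Set.inter_assoc, hindep s (t ∩ u) hs (MeasurableSet.inter ht' hu'), hindep' t u ht hu,
      hindep s t hs ht', mul_assoc]

/-- The σ-algebra generated by `x0` and the arrivals strictly before time `k`. The state at time `k`
is measurable with respect to it, and the arrival at time `k` is independent of it. -/
@[reducible] def history {n : ℕ} (x0 : Ω → Fin n → ℝ) (η : ℕ → Ω → Bool) (k : ℕ) :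
    MeasurableSpace Ω :=
  MeasurableSpace.comap x0 inferInstance ⊔
    ⨆ j ∈ Set.Iio k, MeasurableSpace.comap (η j) inferInstance

section Inclusions

variable {n : ℕ} {x0 : Ω → Fin n → ℝ} {η : ℕ → Ω → Bool} {x : ℕ → Ω → Fin n → ℝ}

theorem history_mono : Monotone (history x0 η) := fun _ _ h =>
  sup_le_sup le_rfl (biSup_mono fun _ hj => lt_of_lt_of_le hj h)

theorem measurable_history_zero : Measurable[history x0 η 0] x0 :=
  (comap_measurable x0).mono le_sup_left le_rfl

theorem remoteSigma_zero (η : ℕ → Ω → Bool) (x : ℕ → Ω → Fin n → ℝ) : remoteSigma η x 0 =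
    ⊥ ⊔ MeasurableSpace.comap (fun ω => received (η 0 ω) (x 0 ω)) inferInstance := by
  rw [bot_sup_eq]
  exact ciSup_unique (s := fun j : Fin 1 =>
    MeasurableSpace.comap (fun ω => received (η j ω) (x j ω)) inferInstance)

theorem remoteSigma_succ (η : ℕ → Ω → Bool) (x : ℕ → Ω → Fin n → ℝ) (k : ℕ) :
    remoteSigma η x (k + 1) = remoteSigma η x k ⊔
      MeasurableSpace.comap (fun ω => received (η (k + 1) ω) (x (k + 1) ω)) inferInstance := by
  let signalSigma (j : Fin (k + 2)) : MeasurableSpace Ω :=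
    MeasurableSpace.comap (fun ω => received (η j ω) (x j ω)) inferInstance
  refine le_antisymm (iSup_le fun j => ?_) (sup_le (iSup_le fun j => ?_) ?_)
  · induction j using Fin.lastCases with
    | last => exact le_sup_right
    | cast j => exact le_sup_of_le_left (le_iSup (fun j : Fin (k + 1) => signalSigma j.castSucc) j)
  · exact le_iSup signalSigma j.castSucc
  · exact le_iSup signalSigma (Fin.last (k + 1))

theorem localSigma_mono : Monotone (localSigma η x) :=
  monotone_nat_of_le_succ fun k => sup_le_sup le_rfl (by rw [remoteSigma_succ]; exact le_sup_left)

theorem localSigma_le_history (hx0 : x 0 = x0) {k : ℕ}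
    (hx : ∀ j ≤ k, Measurable[history x0 η j] (x j)) : localSigma η x k ≤ history x0 η (k + 1) := by
  refine sup_le (hx0 ▸ le_sup_left) (iSup_le fun j => ?_)
  have hη : Measurable[history x0 η (k + 1)] (η j) := by
    rw [measurable_iff_comap_le]
    exact le_sup_of_le_right (le_iSup₂_of_le (j : ℕ) (Set.mem_Iio.mpr j.isLt) le_rfl)
  have hxj : Measurable[history x0 η (k + 1)] (x j) :=
    (hx j (Nat.lt_succ_iff.mp j.isLt)).mono (history_mono j.isLt.le) le_rfl
  exact (measurable_received hη hxj).comap_le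

end Inclusions

variable [MeasurableSpace Ω] {μ : Measure Ω} {n : ℕ} {p : ℝ} {x0 : Ω → Fin n → ℝ}
  {η : ℕ → Ω → Bool}

theorem IsSetting.history_le (h : IsSetting μ p x0 η) (k : ℕ) :
    history x0 η k ≤ (inferInstance : MeasurableSpace Ω) :=
  sup_le h.measurable_x0.comap_le (iSup₂_le fun j _ => (h.measurable_η j).comap_le)

theorem IsSetting.indep_history [IsProbabilityMeasure μ] (h : IsSetting μ p x0 η) (k : ℕ) :
    Indep (history x0 η k) (MeasurableSpace.comap (η k) inferInstance) μ := by
  have hle (j : ℕ) : MeasurableSpace.comap (η j) inferInstance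
      ≤ MeasurableSpace.comap (fun ω k => η k ω) inferInstance :=
    ((measurable_pi_apply j).comp (comap_measurable fun (ω : Ω) (k : ℕ) => η k ω)).comap_le
  have hpast : Indep (⨆ j ∈ Set.Iio k, MeasurableSpace.comap (η j) inferInstance)
      (MeasurableSpace.comap (η k) inferInstance) μ := by
    simpa using indep_iSup_of_disjoint (fun j => (h.measurable_η j).comap_le) h.indep_η.iIndep
      (S := Set.Iio k) (T := {k}) (by simp)
  exact indep_sup_left h.measurable_x0.comap_le (iSup₂_le fun j _ => (h.measurable_η j).comap_le)
    (h.measurable_η k).comap_le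
    (indep_of_indep_of_le_right h.indep_x0_η (sup_le (iSup₂_le fun j _ => hle j) (hle k))) hpast

theorem IsSetting.memLp_x0 (h : IsSetting μ p x0 η) : MemLp x0 2 μ := by
  have := h.gaussian_x0
  exact (memLp_map_measure_iff aestronglyMeasurable_id h.measurable_x0.aemeasurable).mp
    (IsGaussian.memLp_two_id (μ := μ.map x0))

theorem IsSetting.remoteSigma_zero_le (h : IsSetting μ p x0 η) {x : ℕ → Ω → Fin n → ℝ}
    (hx0 : x 0 = x0) : remoteSigma η x 0 ≤ (inferInstance : MeasurableSpace Ω) := by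
  rw [remoteSigma_zero, bot_sup_eq, hx0]
  exact (measurable_received (h.measurable_η 0) h.measurable_x0).comap_le

end ChannelHistory

theorem integral_riccatiMap_completeSquare {Ω : Type*} [MeasurableSpace Ω] {μ : Measure Ω}
    {ι κ : Type*} [Fintype ι] [Fintype κ] [DecidableEq κ] {A Q V : Matrix ι ι ℝ} {B : Matrix ι κ ℝ}
    {R : Matrix κ κ ℝ} (hR : R.PosDef) (hV : V.PosSemidef) {v : Ω → ι → ℝ} {u : Ω → κ → ℝ}
    (hv : MemLp v 2 μ) (hu : MemLp u 2 μ) :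
    ∫ ω, (A *ᵥ v ω + B *ᵥ u ω) ⬝ᵥ V *ᵥ (A *ᵥ v ω + B *ᵥ u ω) ∂μ + ∫ ω, v ω ⬝ᵥ Q *ᵥ v ω ∂μ
        + ∫ ω, u ω ⬝ᵥ R *ᵥ u ω ∂μ
      = ∫ ω, v ω ⬝ᵥ riccatiMap A B Q R V *ᵥ v ω ∂μ
        + ∫ ω, (u ω + riccatiGain A B R V *ᵥ v ω) ⬝ᵥ
            (Bᵀ * V * B + R) *ᵥ (u ω + riccatiGain A B R V *ᵥ v ω) ∂μ := by
  have hnext : MemLp (fun ω => A *ᵥ v ω + B *ᵥ u ω) 2 μ :=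
    (memLp_mulVec hv A).add (memLp_mulVec hu B)
  have hdev : MemLp (fun ω => u ω + riccatiGain A B R V *ᵥ v ω) 2 μ := hu.add (memLp_mulVec hv _)
  rw [← integral_add (integrable_dotProduct_mulVec hnext hnext V)
      (integrable_dotProduct_mulVec hv hv Q),
    ← integral_add ((integrable_dotProduct_mulVec hnext hnext V).fun_add
      (integrable_dotProduct_mulVec hv hv Q)) (integrable_dotProduct_mulVec hu hu R),
    ← integral_add (integrable_dotProduct_mulVec hv hv _)
      (integrable_dotProduct_mulVec hdev hdev _)]
  exact integral_congr_ae (ae_of_all _ fun ω => riccatiMap_completeSquare hR hV (v ω) (u ω))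

theorem memLp_sumElim {Ω : Type*} [MeasurableSpace Ω] {μ : Measure Ω} {ι κ : Type*} [Fintype ι]
    [Fintype κ] {f : Ω → ι → ℝ} {g : Ω → κ → ℝ} (hf : MemLp f 2 μ) (hg : MemLp g 2 μ) :
    MemLp (fun ω => Sum.elim (f ω) (g ω)) 2 μ := by
  classical
  refine ((memLp_mulVec hf (fromRows (1 : Matrix ι ι ℝ) (0 : Matrix κ ι ℝ))).add
    (memLp_mulVec hg (fromRows (0 : Matrix ι κ ℝ) (1 : Matrix κ κ ℝ)))).ae_eq
      (ae_of_all _ fun ω => ?_)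
  ext i
  cases i <;> simp [fromRows_mulVec]

namespace NCS

section Trajectories

variable {n l r : ℕ} {S : NCS n l r} {Ω : Type*} {x0 : Ω → Fin n → ℝ} {η : ℕ → Ω → Bool}
  {uL : ℕ → Ω → Fin l → ℝ} {uR : ℕ → Ω → Fin r → ℝ} {x : ℕ → Ω → Fin n → ℝ}

theorem IsTrajectory.succ_eq (h : S.IsTrajectory x0 uL uR x) (k : ℕ) :
    x (k + 1) = fun ω => S.A *ᵥ x k ω + S.BL *ᵥ uL k ω + S.BR *ᵥ uR k ω :=
  funext (h.2 k)

theorem IsTrajectory.measurable_succ {m : MeasurableSpace Ω} (h : S.IsTrajectory x0 uL uR x)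
    {k : ℕ} (hx : Measurable (x k)) (hL : Measurable (uL k)) (hR : Measurable (uR k)) :
    Measurable (x (k + 1)) := by
  rw [h.succ_eq k]
  exact ((measurable_mulVec hx S.A).add (measurable_mulVec hL S.BL)).add (measurable_mulVec hR S.BR)

theorem IsTrajectory.memLp_succ [MeasurableSpace Ω] {μ : Measure Ω}
    (h : S.IsTrajectory x0 uL uR x) {k : ℕ} (hx : MemLp (x k) 2 μ) (hL : MemLp (uL k) 2 μ)
    (hR : MemLp (uR k) 2 μ) : MemLp (x (k + 1)) 2 μ := by
  rw [h.succ_eq k]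
  exact ((memLp_mulVec hx S.A).add (memLp_mulVec hL S.BL)).add (memLp_mulVec hR S.BR)

theorem IsAdmissible.measurable_history (h : S.IsAdmissible x0 η uL uR x) (k : ℕ) :
    Measurable[history x0 η k] (x k) := by
  induction k using Nat.strong_induction_on with
  | _ k ih =>
  cases k with
  | zero => rw [h.1.1]; exact measurable_history_zero
  | succ k =>
    have hle := _root_.localSigma_le_history h.1.1 fun j hj => ih j (Nat.lt_succ_of_le hj)
    exact h.1.measurable_succ ((ih k k.lt_succ_self).mono (history_mono k.le_succ) le_rfl)
      ((h.2.1 k).mono hle le_rfl) ((h.2.2 k).mono (le_sup_right.trans hle) le_rfl)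

theorem IsAdmissible.localSigma_le_history (h : S.IsAdmissible x0 η uL uR x) (k : ℕ) :
    localSigma η x k ≤ history x0 η (k + 1) :=
  _root_.localSigma_le_history h.1.1 fun j _ => h.measurable_history j

theorem IsAdmissible.remoteSigma_le_history (h : S.IsAdmissible x0 η uL uR x) (k : ℕ) :
    remoteSigma η x k ≤ history x0 η (k + 1) :=
  le_sup_right.trans (h.localSigma_le_history k)

/-- An admissible pair of controls with finite second moments, in a probabilistic setting with the
loss probability of the system. -/
structure IsSquareIntegrable [MeasurableSpace Ω] (S : NCS n l r) (μ : Measure Ω)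
    (x0 : Ω → Fin n → ℝ) (η : ℕ → Ω → Bool) (uL : ℕ → Ω → Fin l → ℝ) (uR : ℕ → Ω → Fin r → ℝ)
    (x : ℕ → Ω → Fin n → ℝ) : Prop where
  isSetting : IsSetting μ S.p x0 η
  isAdmissible : S.IsAdmissible x0 η uL uR x
  memLp_uL : ∀ k, MemLp (uL k) 2 μ
  memLp_uR : ∀ k, MemLp (uR k) 2 μ

theorem IsSquareIntegrable.memLp_x [MeasurableSpace Ω] {μ : Measure Ω}
    (h : S.IsSquareIntegrable μ x0 η uL uR x) (k : ℕ) : MemLp (x k) 2 μ := by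
  induction k with
  | zero => rw [h.isAdmissible.1.1]; exact h.isSetting.memLp_x0
  | succ k ih => exact h.isAdmissible.1.memLp_succ ih (h.memLp_uL k) (h.memLp_uR k)

theorem IsSquareIntegrable.remoteSigma_le [m₀ : MeasurableSpace Ω] {μ : Measure Ω}
    (h : S.IsSquareIntegrable μ x0 η uL uR x) (k : ℕ) : remoteSigma η x k ≤ m₀ :=
  (h.isAdmissible.remoteSigma_le_history k).trans (h.isSetting.history_le (k + 1))

end Trajectories

end NCS

section ExpectedValue

variable {n : ℕ} {Ω : Type*} [MeasurableSpace Ω] {μ : Measure Ω} {η : ℕ → Ω → Bool}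
  {x : ℕ → Ω → Fin n → ℝ} {Z X : Matrix (Fin n) (Fin n) ℝ} {k : ℕ}

/-- The expectation of the value function `x̂' Z x̂ + x̃' X x̃` at time `k`. -/
noncomputable def expectedValue (μ : Measure Ω) (η : ℕ → Ω → Bool) (x : ℕ → Ω → Fin n → ℝ)
    (Z X : Matrix (Fin n) (Fin n) ℝ) (k : ℕ) : ℝ :=
  ∫ ω, (estimate μ η x k ω ⬝ᵥ Z *ᵥ estimate μ η x k ω
    + estError μ η x k ω ⬝ᵥ X *ᵥ estError μ η x k ω) ∂μ

theorem expectedValue_nonneg (hZ : Z.PosSemidef) (hX : X.PosSemidef) (k : ℕ) :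
    0 ≤ expectedValue μ η x Z X k :=
  integral_nonneg fun _ =>
    add_nonneg (dotProduct_mulVec_self_nonneg hZ _) (dotProduct_mulVec_self_nonneg hX _)

theorem memLp_estimate (hx : MemLp (x k) 2 μ) : MemLp (estimate μ η x k) 2 μ :=
  hx.condExp one_le_two

theorem memLp_estError (hx : MemLp (x k) 2 μ) : MemLp (estError μ η x k) 2 μ :=
  hx.sub (memLp_estimate hx)

theorem expectedValue_eq_add (hx : MemLp (x k) 2 μ) (Z X : Matrix (Fin n) (Fin n) ℝ) :
    expectedValue μ η x Z X k = ∫ ω, estimate μ η x k ω ⬝ᵥ Z *ᵥ estimate μ η x k ω ∂μ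
      + ∫ ω, estError μ η x k ω ⬝ᵥ X *ᵥ estError μ η x k ω ∂μ :=
  integral_add (integrable_dotProduct_mulVec (memLp_estimate hx) (memLp_estimate hx) Z)
    (integrable_dotProduct_mulVec (memLp_estError hx) (memLp_estError hx) X)

theorem expectedValue_mono {Z' X' : Matrix (Fin n) (Fin n) ℝ} (hx : MemLp (x k) 2 μ) (hZ : Z ≤ Z')
    (hX : X ≤ X') : expectedValue μ η x Z X k ≤ expectedValue μ η x Z' X' k := by
  have hestimate : MemLp (estimate μ η x k) 2 μ := memLp_estimate hx
  have hestError : MemLp (estError μ η x k) 2 μ := memLp_estError hx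
  have hint (Z X : Matrix (Fin n) (Fin n) ℝ) :=
    (integrable_dotProduct_mulVec hestimate hestimate Z).fun_add
      (integrable_dotProduct_mulVec hestError hestError X)
  exact integral_mono (hint Z X) (hint Z' X') fun ω =>
    add_le_add (dotProduct_mulVec_le_of_le hZ _) (dotProduct_mulVec_le_of_le hX _)

variable [IsFiniteMeasure μ]

theorem integral_dotProduct_mulVec_eq_estimate_add_estError
    (hm : remoteSigma η x k ≤ (inferInstance : MeasurableSpace Ω)) (hx : MemLp (x k) 2 μ)
    (V : Matrix (Fin n) (Fin n) ℝ) :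
    ∫ ω, x k ω ⬝ᵥ V *ᵥ x k ω ∂μ = ∫ ω, estimate μ η x k ω ⬝ᵥ V *ᵥ estimate μ η x k ω ∂μ
      + ∫ ω, estError μ η x k ω ⬝ᵥ V *ᵥ estError μ η x k ω ∂μ :=
  integral_dotProduct_mulVec_eq_condExp_add_residual hm hx V

theorem expectedValue_self (hm : remoteSigma η x k ≤ (inferInstance : MeasurableSpace Ω))
    (hx : MemLp (x k) 2 μ) (V : Matrix (Fin n) (Fin n) ℝ) :
    expectedValue μ η x V V k = ∫ ω, x k ω ⬝ᵥ V *ᵥ x k ω ∂μ := by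
  rw [expectedValue_eq_add hx, integral_dotProduct_mulVec_eq_estimate_add_estError hm hx]

end ExpectedValue

namespace NCS

section Gains

variable {n l r : ℕ} {S : NCS n l r} {Z X : Matrix (Fin n) (Fin n) ℝ}

/-- The weight of the stacked control `(uL, uR)`. -/
def blockR (S : NCS n l r) : Matrix (Fin l ⊕ Fin r) (Fin l ⊕ Fin r) ℝ :=
  Matrix.fromBlocks S.RL 0 0 S.RR

theorem dotProduct_blockR_mulVec (S : NCS n l r) (a : Fin l → ℝ) (b : Fin r → ℝ) :
    Sum.elim a b ⬝ᵥ S.blockR *ᵥ Sum.elim a b = a ⬝ᵥ S.RL *ᵥ a + b ⬝ᵥ S.RR *ᵥ b := by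
  simp [blockR, fromBlocks_mulVec, sumElim_dotProduct_sumElim]

theorem B_mulVec (S : NCS n l r) (a : Fin l → ℝ) (b : Fin r → ℝ) :
    S.B *ᵥ Sum.elim a b = S.BL *ᵥ a + S.BR *ᵥ b := by
  simp [B, fromCols_mulVec]

theorem posDef_blockR (hRL : S.RL.PosDef) (hRR : S.RR.PosDef) : S.blockR.PosDef := by
  refine PosDef.of_dotProduct_mulVec_pos ?_ fun v hv => ?_
  · rw [blockR, IsHermitian, conjTranspose_eq_transpose_of_trivial, fromBlocks_transpose,
      transpose_eq_of_isHermitian hRL.isHermitian, transpose_eq_of_isHermitian hRR.isHermitian,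
      transpose_zero, transpose_zero]
  · rw [star_trivial, ← Sum.elim_comp_inl_inr v, dotProduct_blockR_mulVec]
    have hL := dotProduct_mulVec_self_nonneg hRL.posSemidef (v ∘ Sum.inl)
    have hR := dotProduct_mulVec_self_nonneg hRR.posSemidef (v ∘ Sum.inr)
    by_cases hinl : v ∘ Sum.inl = 0
    · have hinr : v ∘ Sum.inr ≠ 0 := fun hinr => hv <| by
        rw [← Sum.elim_comp_inl_inr v, hinl, hinr]; exact Sum.elim_zero_zero
      exact add_pos_of_nonneg_of_pos hL (by simpa using hRR.dotProduct_mulVec_pos hinr)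
    · exact add_pos_of_pos_of_nonneg (by simpa using hRL.dotProduct_mulVec_pos hinl) hR

theorem K_eq_riccatiGain (S : NCS n l r) (Z : Matrix (Fin n) (Fin n) ℝ) :
    S.K Z = riccatiGain S.A S.B S.blockR Z := by
  simp only [K, riccatiGain, Upsilon, blockR, Matrix.mul_assoc]

theorem posDef_Upsilon (hRL : S.RL.PosDef) (hRR : S.RR.PosDef) (hZ : Z.PosSemidef) :
    (S.Upsilon Z).PosDef :=
  posDef_transpose_mul_mul_add S.B (posDef_blockR hRL hRR) hZ

theorem posDef_Lambda (hRL : S.RL.PosDef) (hΨ : (S.Psi Z X).PosSemidef) : (S.Lambda Z X).PosDef :=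
  posDef_transpose_mul_mul_add S.BL hRL hΨ

theorem riccatiMap_eq_sub_K (hRL : S.RL.PosDef) (hRR : S.RR.PosDef) (hZ : Z.PosSemidef) :
    riccatiMap S.A S.B S.Q S.blockR Z
      = S.Aᵀ * Z * S.A + S.Q - (S.K Z)ᵀ * S.Upsilon Z * S.K Z := by
  have hΥ := posDef_Upsilon hRL hRR hZ
  have hdet : IsUnit (S.Upsilon Z).det := (Matrix.isUnit_iff_isUnit_det _).mp hΥ.isUnit
  have hK : S.K Z = (S.Upsilon Z)⁻¹ * (S.Bᵀ * Z * S.A) := by simp only [K, Matrix.mul_assoc]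
  have hKt : (S.K Z)ᵀ = (S.Bᵀ * Z * S.A)ᵀ * (S.Upsilon Z)⁻¹ := by
    rw [hK, transpose_mul, transpose_nonsing_inv, transpose_eq_of_isHermitian hΥ.isHermitian]
  rw [Matrix.mul_assoc _ (S.Upsilon Z), hKt, hK, mul_nonsing_inv_cancel_left _ _ hdet]
  rfl

/-- The algebraic content of a Riccati solution: `Z` and `X` are fixed by the Riccati operators of
the estimate and of the estimation error, with positive semidefinite arguments. -/
structure IsBellmanPair (S : NCS n l r) (Z X : Matrix (Fin n) (Fin n) ℝ) : Prop where
  posSemidef_Z : Z.PosSemidef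
  posSemidef_Psi : (S.Psi Z X).PosSemidef
  eq_Z : Z = riccatiMap S.A S.B S.Q S.blockR Z
  eq_X : X = riccatiMap S.A S.BL S.Q S.RL (S.Psi Z X)

theorem IsBellmanPair.posSemidef_X (h : S.IsBellmanPair Z X) (hQ : S.Q.PosSemidef)
    (hRL : S.RL.PosDef) : X.PosSemidef := by
  rw [h.eq_X]
  exact posSemidef_riccatiMap hRL hQ h.posSemidef_Psi

theorem IsRiccatiSolution.isBellmanPair (h : S.IsRiccatiSolution Z X) (hRL : S.RL.PosDef)
    (hRR : S.RR.PosDef) : S.IsBellmanPair Z X where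
  posSemidef_Z := h.posDef_Z.posSemidef
  posSemidef_Psi := h.posDef_Psi.posSemidef
  eq_Z := h.eq_Z.trans (riccatiMap_eq_sub_K hRL hRR h.posDef_Z.posSemidef).symm
  eq_X := h.eq_X

end Gains

section Bellman

variable {n l r : ℕ} {S : NCS n l r} {Ω : Type*} [MeasurableSpace Ω] {μ : Measure Ω}
  {x0 : Ω → Fin n → ℝ} {η : ℕ → Ω → Bool} {uL : ℕ → Ω → Fin l → ℝ} {uR : ℕ → Ω → Fin r → ℝ}
  {x : ℕ → Ω → Fin n → ℝ} {Z X : Matrix (Fin n) (Fin n) ℝ}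

/-- The running cost at time `k`. -/
def stageCost (S : NCS n l r) (uL : ℕ → Ω → Fin l → ℝ) (uR : ℕ → Ω → Fin r → ℝ)
    (x : ℕ → Ω → Fin n → ℝ) (k : ℕ) (ω : Ω) : ℝ :=
  x k ω ⬝ᵥ S.Q *ᵥ x k ω + uL k ω ⬝ᵥ S.RL *ᵥ uL k ω + uR k ω ⬝ᵥ S.RR *ᵥ uR k ω

/-- The stacked control `(uL, uR)` as estimated by the remote controller: it drives the estimate. -/
noncomputable def jointControl (μ : Measure Ω) (η : ℕ → Ω → Bool) (x : ℕ → Ω → Fin n → ℝ)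
    (uL : ℕ → Ω → Fin l → ℝ) (uR : ℕ → Ω → Fin r → ℝ) (k : ℕ) (ω : Ω) : Fin l ⊕ Fin r → ℝ :=
  Sum.elim ((μ[uL k | remoteSigma η x k]) ω) (uR k ω)

/-- The part of the local control unknown to the remote controller: it drives the estimation
error. -/
noncomputable def controlError (μ : Measure Ω) (η : ℕ → Ω → Bool) (x : ℕ → Ω → Fin n → ℝ)
    (uL : ℕ → Ω → Fin l → ℝ) (k : ℕ) (ω : Ω) : Fin l → ℝ :=
  uL k ω - (μ[uL k | remoteSigma η x k]) ω

namespace IsSquareIntegrable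

variable (h : S.IsSquareIntegrable μ x0 η uL uR x)
include h

theorem memLp_jointControl (k : ℕ) : MemLp (jointControl μ η x uL uR k) 2 μ :=
  memLp_sumElim ((h.memLp_uL k).condExp one_le_two) (h.memLp_uR k)

theorem memLp_controlError (k : ℕ) : MemLp (controlError μ η x uL k) 2 μ :=
  (h.memLp_uL k).sub ((h.memLp_uL k).condExp one_le_two)

variable [IsProbabilityMeasure μ]

theorem condExp_succ (k : ℕ) :
    μ[x (k + 1) | remoteSigma η x k] =ᵐ[μ] fun ω =>
      S.A *ᵥ estimate μ η x k ω + S.B *ᵥ jointControl μ η x uL uR k ω := by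
  have hx := h.memLp_x k
  have hA := (memLp_mulVec hx S.A).integrable one_le_two
  have hBL := (memLp_mulVec (h.memLp_uL k) S.BL).integrable one_le_two
  have hBR := (memLp_mulVec (h.memLp_uR k) S.BR).integrable one_le_two
  have huR : μ[uR k | remoteSigma η x k] = uR k :=
    condExp_of_stronglyMeasurable (h.remoteSigma_le k) (h.isAdmissible.2.2 k).stronglyMeasurable
      ((h.memLp_uR k).integrable one_le_two)
  have hsucc : x (k + 1) = (fun ω => S.A *ᵥ x k ω) + (fun ω => S.BL *ᵥ uL k ω)
      + (fun ω => S.BR *ᵥ uR k ω) := h.isAdmissible.1.succ_eq k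
  rw [hsucc]
  filter_upwards [condExp_add (hA.add hBL) hBR (remoteSigma η x k),
    condExp_add hA hBL (remoteSigma η x k),
    condExp_mulVec (m := remoteSigma η x k) (hx.integrable one_le_two) S.A,
    condExp_mulVec (m := remoteSigma η x k) ((h.memLp_uL k).integrable one_le_two) S.BL,
    condExp_mulVec (m := remoteSigma η x k) ((h.memLp_uR k).integrable one_le_two) S.BR]
    with ω hadd hadd' hmulA hmulBL hmulBR
  rw [hadd, Pi.add_apply, hadd', Pi.add_apply, hmulA, hmulBL, hmulBR, huR, jointControl, B_mulVec,
    add_assoc]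
  rfl

theorem sub_condExp_succ (k : ℕ) :
    (fun ω => x (k + 1) ω - (μ[x (k + 1) | remoteSigma η x k]) ω) =ᵐ[μ] fun ω =>
      S.A *ᵥ estError μ η x k ω + S.BL *ᵥ controlError μ η x uL k ω := by
  filter_upwards [h.condExp_succ k] with ω hω
  rw [hω, h.isAdmissible.1.2 k ω, estError, controlError, jointControl, B_mulVec, mulVec_sub,
    mulVec_sub]
  abel

theorem expectedValue_succ (hp : 0 ≤ S.p) (Z X : Matrix (Fin n) (Fin n) ℝ) (k : ℕ) :
    expectedValue μ η x Z X (k + 1)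
      = ∫ ω, (S.A *ᵥ estimate μ η x k ω + S.B *ᵥ jointControl μ η x uL uR k ω) ⬝ᵥ
          Z *ᵥ (S.A *ᵥ estimate μ η x k ω + S.B *ᵥ jointControl μ η x uL uR k ω) ∂μ
        + ∫ ω, (S.A *ᵥ estError μ η x k ω + S.BL *ᵥ controlError μ η x uL k ω) ⬝ᵥ
          S.Psi Z X *ᵥ (S.A *ᵥ estError μ η x k ω + S.BL *ᵥ controlError μ η x uL k ω) ∂μ := by
  have hestimate : estimate μ η x (k + 1) =ᵐ[μ] μ[x (k + 1) | remoteSigma η x k ⊔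
      MeasurableSpace.comap (fun ω => received (η (k + 1) ω) (x (k + 1) ω)) inferInstance] := by
    rw [estimate, remoteSigma_succ]
  refine (integral_dotProduct_mulVec_sup_received (h.isAdmissible.remoteSigma_le_history k)
    (h.isSetting.history_le (k + 1)) (h.isSetting.measurable_η (k + 1))
    (h.isSetting.indep_history (k + 1)) (h.isAdmissible.measurable_history (k + 1))
    (h.memLp_x (k + 1)) hp (h.isSetting.prob_loss (k + 1)) Z X hestimate).trans ?_
  congr 1
  · refine integral_congr_ae ?_
    filter_upwards [h.condExp_succ k] with ω hω
    rw [hω]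
  · refine integral_congr_ae ?_
    filter_upwards [h.sub_condExp_succ k] with ω hω
    rw [hω, Psi]

theorem integral_stageCost (k : ℕ) :
    ∫ ω, S.stageCost uL uR x k ω ∂μ
      = ∫ ω, estimate μ η x k ω ⬝ᵥ S.Q *ᵥ estimate μ η x k ω ∂μ
        + ∫ ω, jointControl μ η x uL uR k ω ⬝ᵥ S.blockR *ᵥ jointControl μ η x uL uR k ω ∂μ
        + (∫ ω, estError μ η x k ω ⬝ᵥ S.Q *ᵥ estError μ η x k ω ∂μ
        + ∫ ω, controlError μ η x uL k ω ⬝ᵥ S.RL *ᵥ controlError μ η x uL k ω ∂μ) := by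
  have hx := h.memLp_x k
  have huL : MemLp (μ[uL k | remoteSigma η x k]) 2 μ := (h.memLp_uL k).condExp one_le_two
  have hxQ := integrable_dotProduct_mulVec hx hx S.Q
  have huLR := integrable_dotProduct_mulVec (h.memLp_uL k) (h.memLp_uL k) S.RL
  have huRR := integrable_dotProduct_mulVec (h.memLp_uR k) (h.memLp_uR k) S.RR
  simp only [stageCost, jointControl, controlError, dotProduct_blockR_mulVec]
  rw [integral_add (hxQ.fun_add huLR) huRR, integral_add hxQ huLR,
    integral_add (integrable_dotProduct_mulVec huL huL S.RL) huRR,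
    integral_dotProduct_mulVec_eq_estimate_add_estError (h.remoteSigma_le k) hx,
    integral_dotProduct_mulVec_eq_condExp_add_residual (h.remoteSigma_le k) (h.memLp_uL k)]
  ring

theorem integral_stageCost_add_expectedValue_succ (hp : 0 ≤ S.p) (hRL : S.RL.PosDef)
    (hRR : S.RR.PosDef) (hZX : S.IsBellmanPair Z X) (k : ℕ) :
    ∫ ω, S.stageCost uL uR x k ω ∂μ + expectedValue μ η x Z X (k + 1)
      = expectedValue μ η x Z X k
        + ∫ ω, (jointControl μ η x uL uR k ω + S.K Z *ᵥ estimate μ η x k ω) ⬝ᵥ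
            S.Upsilon Z *ᵥ (jointControl μ η x uL uR k ω + S.K Z *ᵥ estimate μ η x k ω) ∂μ
        + ∫ ω, (controlError μ η x uL k ω + S.errorGain Z X *ᵥ estError μ η x k ω) ⬝ᵥ
            S.Lambda Z X *ᵥ (controlError μ η x uL k ω
              + S.errorGain Z X *ᵥ estError μ η x k ω) ∂μ := by
  have hx := h.memLp_x k
  have hestimate := integral_riccatiMap_completeSquare (A := S.A) (B := S.B) (Q := S.Q)
    (posDef_blockR hRL hRR) hZX.posSemidef_Z (memLp_estimate (η := η) hx) (h.memLp_jointControl k)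
  have herror := integral_riccatiMap_completeSquare (A := S.A) (B := S.BL) (Q := S.Q)
    hRL hZX.posSemidef_Psi (memLp_estError (η := η) hx) (h.memLp_controlError k)
  have hΥ : S.Bᵀ * Z * S.B + S.blockR = S.Upsilon Z := rfl
  have hgain : riccatiGain S.A S.BL S.RL (S.Psi Z X) = S.errorGain Z X := rfl
  have hΛ : S.BLᵀ * S.Psi Z X * S.BL + S.RL = S.Lambda Z X := rfl
  rw [← hZX.eq_Z, ← K_eq_riccatiGain, hΥ] at hestimate
  rw [← hZX.eq_X, hgain, hΛ] at herror
  rw [h.integral_stageCost k, h.expectedValue_succ hp, expectedValue_eq_add hx]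
  linarith

end IsSquareIntegrable

end Bellman

section FiniteCost

variable {n l r : ℕ} {S : NCS n l r} {Ω : Type*} {x0 : Ω → Fin n → ℝ} {η : ℕ → Ω → Bool}
  {uL : ℕ → Ω → Fin l → ℝ} {uR : ℕ → Ω → Fin r → ℝ} {x : ℕ → Ω → Fin n → ℝ}

theorem dotProduct_Q_mulVec_le_stageCost (hRL : S.RL.PosDef) (hRR : S.RR.PosDef) (k : ℕ) (ω : Ω) :
    x k ω ⬝ᵥ S.Q *ᵥ x k ω ≤ S.stageCost uL uR x k ω := by
  have hL := dotProduct_mulVec_self_nonneg hRL.posSemidef (uL k ω)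
  have hR := dotProduct_mulVec_self_nonneg hRR.posSemidef (uR k ω)
  rw [stageCost]
  linarith

theorem dotProduct_RL_mulVec_le_stageCost (hQ : S.Q.PosSemidef) (hRR : S.RR.PosDef) (k : ℕ)
    (ω : Ω) : uL k ω ⬝ᵥ S.RL *ᵥ uL k ω ≤ S.stageCost uL uR x k ω := by
  have hx := dotProduct_mulVec_self_nonneg hQ (x k ω)
  have hR := dotProduct_mulVec_self_nonneg hRR.posSemidef (uR k ω)
  rw [stageCost]
  linarith

theorem dotProduct_RR_mulVec_le_stageCost (hQ : S.Q.PosSemidef) (hRL : S.RL.PosDef) (k : ℕ)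
    (ω : Ω) : uR k ω ⬝ᵥ S.RR *ᵥ uR k ω ≤ S.stageCost uL uR x k ω := by
  have hx := dotProduct_mulVec_self_nonneg hQ (x k ω)
  have hL := dotProduct_mulVec_self_nonneg hRL.posSemidef (uL k ω)
  rw [stageCost]
  linarith

theorem stageCost_nonneg (hQ : S.Q.PosSemidef) (hRL : S.RL.PosDef) (hRR : S.RR.PosDef) (k : ℕ)
    (ω : Ω) : 0 ≤ S.stageCost uL uR x k ω :=
  (dotProduct_mulVec_self_nonneg hQ _).trans (dotProduct_Q_mulVec_le_stageCost hRL hRR k ω)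

variable [MeasurableSpace Ω] {μ : Measure Ω}

theorem lintegral_dotProduct_self_le_of_le_stageCost {ι : Type*} [Fintype ι] {f : ℕ → Ω → ι → ℝ}
    {c : ℝ} (hc : 0 ≤ c) (hf : ∀ k ω, f k ω ⬝ᵥ f k ω ≤ c * S.stageCost uL uR x k ω) (k : ℕ) :
    ∫⁻ ω, ENNReal.ofReal (f k ω ⬝ᵥ f k ω) ∂μ
      ≤ ENNReal.ofReal c * ∫⁻ ω, ENNReal.ofReal (S.stageCost uL uR x k ω) ∂μ := by
  rw [← lintegral_const_mul' _ _ ENNReal.ofReal_ne_top]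
  refine lintegral_mono fun ω => ?_
  rw [← ENNReal.ofReal_mul hc]
  exact ENNReal.ofReal_le_ofReal (hf k ω)

section Admissible

variable {p : ℝ} (h : S.IsAdmissible x0 η uL uR x) (hset : IsSetting μ p x0 η)
include h hset

theorem IsAdmissible.measurable_x (k : ℕ) : Measurable (x k) :=
  (h.measurable_history k).mono (hset.history_le k) le_rfl

theorem IsAdmissible.measurable_uL (k : ℕ) : Measurable (uL k) :=
  (h.2.1 k).mono ((h.localSigma_le_history k).trans (hset.history_le _)) le_rfl

theorem IsAdmissible.measurable_uR (k : ℕ) : Measurable (uR k) :=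
  (h.2.2 k).mono ((h.remoteSigma_le_history k).trans (hset.history_le _)) le_rfl

theorem IsAdmissible.cost_eq_tsum :
    S.cost μ uL uR x = ∑' k, ∫⁻ ω, ENNReal.ofReal (S.stageCost uL uR x k ω) ∂μ := by
  refine lintegral_tsum fun k => ?_
  have hx := h.measurable_x hset k
  have hL := h.measurable_uL hset k
  have hR := h.measurable_uR hset k
  exact (((measurable_dotProduct hx (measurable_mulVec hx _)).add
    (measurable_dotProduct hL (measurable_mulVec hL _))).add
    (measurable_dotProduct hR (measurable_mulVec hR _))).ennreal_ofReal.aemeasurable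

variable (hfin : S.cost μ uL uR x ≠ ⊤) {ι : Type*} [Fintype ι] {f : ℕ → Ω → ι → ℝ} {c : ℝ}
  (hc : 0 ≤ c) (hf : ∀ k ω, f k ω ⬝ᵥ f k ω ≤ c * S.stageCost uL uR x k ω)
include hfin hc hf

theorem IsAdmissible.lintegral_dotProduct_self_ne_top (k : ℕ) :
    ∫⁻ ω, ENNReal.ofReal (f k ω ⬝ᵥ f k ω) ∂μ ≠ ⊤ := by
  rw [h.cost_eq_tsum hset] at hfin
  exact ne_top_of_le_ne_top
    (ENNReal.mul_ne_top ENNReal.ofReal_ne_top (ENNReal.ne_top_of_tsum_ne_top hfin k))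
    (lintegral_dotProduct_self_le_of_le_stageCost hc hf k)

theorem IsAdmissible.msTendstoZero : MSTendstoZero μ f := by
  rw [h.cost_eq_tsum hset] at hfin
  exact .of_lintegral_le (ENNReal.tendsto_atTop_zero_of_tsum_ne_top hfin)
    (lintegral_dotProduct_self_le_of_le_stageCost hc hf)

end Admissible

variable (hQ : S.Q.PosSemidef) (hRL : S.RL.PosDef) (hRR : S.RR.PosDef)
include hQ hRL hRR

theorem IsAdmissible.isSquareIntegrable (h : S.IsAdmissible x0 η uL uR x)
    (hset : IsSetting μ S.p x0 η) (hfin : S.cost μ uL uR x ≠ ⊤) :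
    S.IsSquareIntegrable μ x0 η uL uR x := by
  obtain ⟨cL, hcL, hL⟩ := exists_dotProduct_self_le_of_posDef hRL
  obtain ⟨cR, hcR, hR⟩ := exists_dotProduct_self_le_of_posDef hRR
  refine ⟨hset, h, fun k => ?_, fun k => ?_⟩
  · refine memLp_two_of_lintegral_dotProduct_self_ne_top (h.measurable_uL hset k)
      (h.lintegral_dotProduct_self_ne_top hset hfin hcL (fun k ω => (hL _).trans ?_) k)
    exact mul_le_mul_of_nonneg_left (dotProduct_RL_mulVec_le_stageCost hQ hRR k ω) hcL
  · refine memLp_two_of_lintegral_dotProduct_self_ne_top (h.measurable_uR hset k)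
      (h.lintegral_dotProduct_self_ne_top hset hfin hcR (fun k ω => (hR _).trans ?_) k)
    exact mul_le_mul_of_nonneg_left (dotProduct_RR_mulVec_le_stageCost hQ hRL k ω) hcR

theorem IsAdmissible.msTendstoZero_x {p : ℝ} (h : S.IsAdmissible x0 η uL uR x)
    (hset : IsSetting μ p x0 η) (hobs : Observable S.A (CFC.sqrt S.Q))
    (hfin : S.cost μ uL uR x ≠ ⊤) : MSTendstoZero μ x := by
  obtain ⟨cL, hcL, hL⟩ := exists_dotProduct_self_le_of_posDef hRL
  obtain ⟨cR, hcR, hR⟩ := exists_dotProduct_self_le_of_posDef hRR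
  have huL : MSTendstoZero μ uL := h.msTendstoZero hset hfin hcL fun k ω => (hL _).trans
    (mul_le_mul_of_nonneg_left (dotProduct_RL_mulVec_le_stageCost hQ hRR k ω) hcL)
  have huR : MSTendstoZero μ uR := h.msTendstoZero hset hfin hcR fun k ω => (hR _).trans
    (mul_le_mul_of_nonneg_left (dotProduct_RR_mulVec_le_stageCost hQ hRL k ω) hcR)
  have houtput : MSTendstoZero μ fun k ω => CFC.sqrt S.Q *ᵥ x k ω :=
    h.msTendstoZero hset hfin zero_le_one fun k ω => by
      rw [dotProduct_sqrt_mulVec_self hQ, one_mul]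
      exact dotProduct_Q_mulVec_le_stageCost hRL hRR k ω
  have hBL (k : ℕ) : Measurable fun ω => S.BL *ᵥ uL k ω :=
    measurable_mulVec (h.measurable_uL hset k) _
  have hBR (k : ℕ) : Measurable fun ω => S.BR *ᵥ uR k ω :=
    measurable_mulVec (h.measurable_uR hset k) _
  exact .of_observable hobs (fun k ω => by rw [h.1.2 k ω, add_assoc]; rfl) (h.measurable_x hset)
    (fun k => (hBL k).add (hBR k)) ((huL.mulVec S.BL).add (huR.mulVec S.BR) hBL hBR) houtput

theorem IsSquareIntegrable.cost_eq_tsum_integral (h : S.IsSquareIntegrable μ x0 η uL uR x) :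
    S.cost μ uL uR x = ∑' k, ENNReal.ofReal (∫ ω, S.stageCost uL uR x k ω ∂μ) := by
  rw [h.isAdmissible.cost_eq_tsum h.isSetting]
  refine tsum_congr fun k => (ofReal_integral_eq_lintegral_ofReal ?_
    (ae_of_all _ (stageCost_nonneg hQ hRL hRR k))).symm
  exact ((integrable_dotProduct_mulVec (h.memLp_x k) (h.memLp_x k) _).fun_add
    (integrable_dotProduct_mulVec (h.memLp_uL k) (h.memLp_uL k) _)).fun_add
    (integrable_dotProduct_mulVec (h.memLp_uR k) (h.memLp_uR k) _)

end FiniteCost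

section LowerBound

variable {n l r : ℕ} {S : NCS n l r} {Ω : Type*} [MeasurableSpace Ω] {μ : Measure Ω}
  [IsProbabilityMeasure μ] {x0 : Ω → Fin n → ℝ} {η : ℕ → Ω → Bool}
  {uL : ℕ → Ω → Fin l → ℝ} {uR : ℕ → Ω → Fin r → ℝ} {x : ℕ → Ω → Fin n → ℝ}
  {Z X : Matrix (Fin n) (Fin n) ℝ}

theorem IsSquareIntegrable.tendsto_expectedValue (h : S.IsSquareIntegrable μ x0 η uL uR x)
    (hZ : Z.PosSemidef) (hX : X.PosSemidef) (hx : MSTendstoZero μ x) :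
    Tendsto (expectedValue μ η x Z X) atTop (𝓝 0) := by
  obtain ⟨c, -, hc⟩ := exists_dotProduct_mulVec_le (Z + X)
  have hlim := (hx.tendsto_integral h.memLp_x).const_mul c
  rw [mul_zero] at hlim
  refine squeeze_zero (expectedValue_nonneg hZ hX) (fun k => ?_) hlim
  have hxk := h.memLp_x k
  calc expectedValue μ η x Z X k
      ≤ expectedValue μ η x (Z + X) (Z + X) k :=
        expectedValue_mono hxk (le_add_of_nonneg_right hX.nonneg) (le_add_of_nonneg_left hZ.nonneg)
    _ = ∫ ω, x k ω ⬝ᵥ (Z + X) *ᵥ x k ω ∂μ := expectedValue_self (h.remoteSigma_le k) hxk _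
    _ ≤ ∫ ω, c * (x k ω ⬝ᵥ x k ω) ∂μ :=
        integral_mono (integrable_dotProduct_mulVec hxk hxk _)
          ((integrable_dotProduct hxk hxk).const_mul c) fun ω => hc (x k ω)
    _ = c * ∫ ω, x k ω ⬝ᵥ x k ω ∂μ := integral_const_mul _ _

variable (hp : 0 ≤ S.p) (hQ : S.Q.PosSemidef) (hRL : S.RL.PosDef) (hRR : S.RR.PosDef)
  (hZX : S.IsBellmanPair Z X)
include hp hRL hRR hZX

theorem IsSquareIntegrable.expectedValue_sub_succ_le (h : S.IsSquareIntegrable μ x0 η uL uR x)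
    (k : ℕ) : expectedValue μ η x Z X k - expectedValue μ η x Z X (k + 1)
      ≤ ∫ ω, S.stageCost uL uR x k ω ∂μ := by
  have hbellman := h.integral_stageCost_add_expectedValue_succ hp hRL hRR hZX k
  have hΥ := integral_dotProduct_mulVec_self_nonneg (μ := μ)
    (posDef_Upsilon hRL hRR hZX.posSemidef_Z).posSemidef
    fun ω => jointControl μ η x uL uR k ω + S.K Z *ᵥ estimate μ η x k ω
  have hΛ := integral_dotProduct_mulVec_self_nonneg (μ := μ)
    (posDef_Lambda hRL hZX.posSemidef_Psi).posSemidef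
    fun ω => controlError μ η x uL k ω + S.errorGain Z X *ᵥ estError μ η x k ω
  linarith

include hQ

theorem IsAdmissible.expectedValue_le_cost (h : S.IsAdmissible x0 η uL uR x)
    (hset : IsSetting μ S.p x0 η) (hobs : Observable S.A (CFC.sqrt S.Q)) :
    ENNReal.ofReal (expectedValue μ η x Z X 0) ≤ S.cost μ uL uR x := by
  by_cases hfin : S.cost μ uL uR x = ⊤
  · exact hfin ▸ le_top
  have hsq := h.isSquareIntegrable hQ hRL hRR hset hfin
  have hlim := (hsq.tendsto_expectedValue hZX.posSemidef_Z (hZX.posSemidef_X hQ hRL)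
    (h.msTendstoZero_x hQ hRL hRR hset hobs hfin)).const_sub (expectedValue μ η x Z X 0)
  rw [sub_zero] at hlim
  refine le_of_tendsto' ((ENNReal.continuous_ofReal.tendsto _).comp hlim) fun N => ?_
  calc ENNReal.ofReal (expectedValue μ η x Z X 0 - expectedValue μ η x Z X N)
      = ENNReal.ofReal (∑ k ∈ Finset.range N,
          (expectedValue μ η x Z X k - expectedValue μ η x Z X (k + 1))) := by
        rw [Finset.sum_range_sub']
    _ ≤ ENNReal.ofReal (∑ k ∈ Finset.range N, ∫ ω, S.stageCost uL uR x k ω ∂μ) :=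
        ENNReal.ofReal_le_ofReal <| Finset.sum_le_sum fun k _ =>
          hsq.expectedValue_sub_succ_le hp hRL hRR hZX k
    _ = ∑ k ∈ Finset.range N, ENNReal.ofReal (∫ ω, S.stageCost uL uR x k ω ∂μ) :=
        ENNReal.ofReal_sum_of_nonneg fun k _ => integral_nonneg (stageCost_nonneg hQ hRL hRR k)
    _ ≤ S.cost μ uL uR x := by
        rw [hsq.cost_eq_tsum_integral hQ hRL hRR]
        exact ENNReal.sum_le_tsum (Finset.range N)

end LowerBound

section ClosedLoop

variable {n l r : ℕ} {S : NCS n l r} {Ω : Type*} [MeasurableSpace Ω] {μ : Measure Ω}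
  {x0 : Ω → Fin n → ℝ} {η : ℕ → Ω → Bool}

theorem isAdmissible_closedLoop (S : NCS n l r) (μ : Measure Ω) (x0 : Ω → Fin n → ℝ)
    (η : ℕ → Ω → Bool) (K1 : Matrix (Fin r) (Fin n) ℝ) (K2 L : Matrix (Fin l) (Fin n) ℝ) :
    S.IsAdmissible x0 η (localFeedback μ η K2 L (S.closedLoop μ x0 η K1 K2 L))
      (remoteFeedback μ η K1 (S.closedLoop μ x0 η K1 K2 L)) (S.closedLoop μ x0 η K1 K2 L) := by
  have htraj := S.closedLoop_isTrajectory μ x0 η K1 K2 L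
  set x := S.closedLoop μ x0 η K1 K2 L
  have hestimate (k : ℕ) : Measurable[remoteSigma η x k] (estimate μ η x k) :=
    stronglyMeasurable_condExp.measurable
  have hestimate' (k : ℕ) : Measurable[localSigma η x k] (estimate μ η x k) :=
    (hestimate k).mono le_sup_right le_rfl
  have huR (k : ℕ) : Measurable[remoteSigma η x k] (remoteFeedback μ η K1 x k) :=
    (measurable_mulVec (hestimate k) K1).neg
  have huL (k : ℕ) (hx : Measurable[localSigma η x k] (x k)) :
      Measurable[localSigma η x k] (localFeedback μ η K2 L x k) :=
    (measurable_mulVec (hestimate' k) K2).neg.sub (measurable_mulVec (hx.sub (hestimate' k)) L)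
  have hx (k : ℕ) : Measurable[localSigma η x k] (x k) := by
    induction k with
    | zero => exact (comap_measurable (x 0)).mono le_sup_left le_rfl
    | succ k ih =>
      exact (htraj.measurable_succ ih (huL k ih) ((huR k).mono le_sup_right le_rfl)).mono
        (localSigma_mono k.le_succ) le_rfl
  exact ⟨htraj, fun k => huL k (hx k), huR⟩

theorem memLp_remoteFeedback {x : ℕ → Ω → Fin n → ℝ} {k : ℕ} (hx : MemLp (x k) 2 μ)
    (K1 : Matrix (Fin r) (Fin n) ℝ) : MemLp (remoteFeedback μ η K1 x k) 2 μ :=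
  (memLp_mulVec (memLp_estimate hx) K1).neg

theorem memLp_localFeedback {x : ℕ → Ω → Fin n → ℝ} {k : ℕ} (hx : MemLp (x k) 2 μ)
    (K2 L : Matrix (Fin l) (Fin n) ℝ) : MemLp (localFeedback μ η K2 L x k) 2 μ :=
  (memLp_mulVec (memLp_estimate hx) K2).neg.sub (memLp_mulVec (memLp_estError hx) L)

theorem isSquareIntegrable_closedLoop (hset : IsSetting μ S.p x0 η)
    (K1 : Matrix (Fin r) (Fin n) ℝ) (K2 L : Matrix (Fin l) (Fin n) ℝ) :
    S.IsSquareIntegrable μ x0 η (localFeedback μ η K2 L (S.closedLoop μ x0 η K1 K2 L))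
      (remoteFeedback μ η K1 (S.closedLoop μ x0 η K1 K2 L)) (S.closedLoop μ x0 η K1 K2 L) := by
  have htraj := S.closedLoop_isTrajectory μ x0 η K1 K2 L
  have hx (k : ℕ) : MemLp (S.closedLoop μ x0 η K1 K2 L k) 2 μ := by
    induction k with
    | zero => rw [htraj.1]; exact hset.memLp_x0
    | succ k ih =>
      exact htraj.memLp_succ ih (memLp_localFeedback ih K2 L) (memLp_remoteFeedback ih K1)
  exact ⟨hset, S.isAdmissible_closedLoop μ x0 η K1 K2 L,
    fun k => memLp_localFeedback (hx k) K2 L, fun k => memLp_remoteFeedback (hx k) K1⟩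

variable [IsProbabilityMeasure μ]

theorem condExp_localFeedback {x : ℕ → Ω → Fin n → ℝ} {k : ℕ}
    (hm : remoteSigma η x k ≤ (inferInstance : MeasurableSpace Ω)) (hx : MemLp (x k) 2 μ)
    (K2 L : Matrix (Fin l) (Fin n) ℝ) :
    μ[localFeedback μ η K2 L x k | remoteSigma η x k] =ᵐ[μ]
      fun ω => -(K2 *ᵥ estimate μ η x k ω) := by
  have hestimate := (memLp_mulVec (memLp_estimate (η := η) hx) K2).neg.integrable one_le_two
  have hestError : Integrable (estError μ η x k) μ := (memLp_estError hx).integrable one_le_two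
  have hLestError := (memLp_mulVec (memLp_estError (η := η) hx) L).integrable one_le_two
  have hzero : μ[estError μ η x k | remoteSigma η x k] =ᵐ[μ] 0 :=
    condExp_sub_condExp_eq_zero hm (hx.integrable one_le_two)
  have hmeasurable : Measurable[remoteSigma η x k] (-fun ω => K2 *ᵥ estimate μ η x k ω) :=
    (measurable_mulVec stronglyMeasurable_condExp.measurable K2).neg
  have hself := condExp_of_stronglyMeasurable hm hmeasurable.stronglyMeasurable hestimate
  filter_upwards [condExp_sub hestimate hLestError (remoteSigma η x k),
    condExp_mulVec_eq_zero hestError hzero L] with ω hsub hLzero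
  refine hsub.trans ?_
  rw [Pi.sub_apply, hLzero, hself, Pi.zero_apply, sub_zero]
  rfl

section Feedback

variable (hset : IsSetting μ S.p x0 η) (K1 : Matrix (Fin r) (Fin n) ℝ)
  (K2 L : Matrix (Fin l) (Fin n) ℝ) {x : ℕ → Ω → Fin n → ℝ}
  (hx : x = S.closedLoop μ x0 η K1 K2 L) (k : ℕ)
include hset hx

theorem jointControl_closedLoop :
    jointControl μ η x (localFeedback μ η K2 L x) (remoteFeedback μ η K1 x) k =ᵐ[μ]
      fun ω => -(fromRows K2 K1 *ᵥ estimate μ η x k ω) := by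
  have hsq := isSquareIntegrable_closedLoop hset K1 K2 L
  rw [← hx] at hsq
  filter_upwards [condExp_localFeedback (hsq.remoteSigma_le k) (hsq.memLp_x k) K2 L] with ω hω
  rw [jointControl, hω, fromRows_mulVec]
  ext i
  cases i <;> rfl

theorem controlError_closedLoop :
    controlError μ η x (localFeedback μ η K2 L x) k =ᵐ[μ]
      fun ω => -(L *ᵥ estError μ η x k ω) := by
  have hsq := isSquareIntegrable_closedLoop hset K1 K2 L
  rw [← hx] at hsq
  filter_upwards [condExp_localFeedback (hsq.remoteSigma_le k) (hsq.memLp_x k) K2 L] with ω hω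
  rw [controlError, hω, localFeedback]
  abel

end Feedback

section Optimal

variable {x : ℕ → Ω → Fin n → ℝ} {Z X : Matrix (Fin n) (Fin n) ℝ} (hp : 0 ≤ S.p)
  (hQ : S.Q.PosSemidef) (hRL : S.RL.PosDef) (hRR : S.RR.PosDef) (hZX : S.IsBellmanPair Z X)
  (hset : IsSetting μ S.p x0 η)
  (hx : x = S.closedLoop μ x0 η (S.remoteGain Z) (S.localGain Z) (S.errorGain Z X))
include hp hRL hRR hZX hset hx

theorem integral_stageCost_closedLoop (k : ℕ) :
    ∫ ω, S.stageCost (localFeedback μ η (S.localGain Z) (S.errorGain Z X) x)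
        (remoteFeedback μ η (S.remoteGain Z) x) x k ω ∂μ
      = expectedValue μ η x Z X k - expectedValue μ η x Z X (k + 1) := by
  have hsq := isSquareIntegrable_closedLoop hset (S.remoteGain Z) (S.localGain Z) (S.errorGain Z X)
  have hjoint := jointControl_closedLoop hset _ _ _ hx k
  have herror := controlError_closedLoop hset _ _ _ hx k
  rw [← hx] at hsq
  have hK : fromRows (S.localGain Z) (S.remoteGain Z) = S.K Z := fromRows_toRows _
  rw [eq_sub_iff_add_eq, hsq.integral_stageCost_add_expectedValue_succ hp hRL hRR hZX k,
    integral_eq_zero_of_ae, integral_eq_zero_of_ae, add_zero, add_zero]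
  · filter_upwards [herror] with ω hω
    simp [hω]
  · filter_upwards [hjoint] with ω hω
    simp [hω, hK]

include hQ

theorem cost_closedLoop_le :
    S.cost μ (localFeedback μ η (S.localGain Z) (S.errorGain Z X) x)
      (remoteFeedback μ η (S.remoteGain Z) x) x ≤ ENNReal.ofReal (expectedValue μ η x Z X 0) := by
  have hsq := isSquareIntegrable_closedLoop hset (S.remoteGain Z) (S.localGain Z) (S.errorGain Z X)
  rw [← hx] at hsq
  rw [hsq.cost_eq_tsum_integral hQ hRL hRR]
  refine ENNReal.tsum_le_of_sum_range_le fun N => ?_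
  rw [← ENNReal.ofReal_sum_of_nonneg fun k _ => integral_nonneg (stageCost_nonneg hQ hRL hRR k)]
  refine ENNReal.ofReal_le_ofReal ?_
  simp_rw [integral_stageCost_closedLoop hp hRL hRR hZX hset hx]
  rw [Finset.sum_range_sub']
  exact sub_le_self _ (expectedValue_nonneg hZX.posSemidef_Z (hZX.posSemidef_X hQ hRL) N)

end Optimal

end ClosedLoop

end NCS

section InitialValue

variable {n : ℕ} {Ω : Type*} [MeasurableSpace Ω] {μ : Measure Ω} [IsProbabilityMeasure μ] {p : ℝ}
  {x0 : Ω → Fin n → ℝ} {η : ℕ → Ω → Bool} {x : ℕ → Ω → Fin n → ℝ}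

theorem initialValue_eq_expectedValue (hset : IsSetting μ p x0 η) (hx0 : x 0 = x0)
    (Z X : Matrix (Fin n) (Fin n) ℝ) :
    NCS.initialValue μ x0 η Z X = expectedValue μ η x Z X 0 := by
  have hm := hset.remoteSigma_zero_le hx0
  have hx : MemLp (x 0) 2 μ := hx0 ▸ hset.memLp_x0
  have hestimate : estimate μ η (fun _ => x0) 0 = estimate μ η x 0 := by
    rw [estimate, estimate, remoteSigma_zero, remoteSigma_zero, hx0]
  have hestError : estError μ η (fun _ => x0) 0 = estError μ η x 0 := by
    unfold estError
    rw [hestimate, hx0]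
  rw [NCS.initialValue, hestimate, hestError, ← hx0, expectedValue_eq_add hx,
    integral_add (integrable_dotProduct_mulVec hx (memLp_estimate hx) Z)
      (integrable_dotProduct_mulVec hx (memLp_estError hx) X)]
  exact congrArg₂ _ (integral_dotProduct_mulVec_condExp hm hx Z)
    (integral_dotProduct_mulVec_residual hm hx X)

theorem expectedValue_zero (hp : 0 ≤ p) (hset : IsSetting μ p x0 η) (hx0 : x 0 = x0)
    (Z X : Matrix (Fin n) (Fin n) ℝ) :
    expectedValue μ η x Z X 0 = (∫ ω, x0 ω ∂μ) ⬝ᵥ Z *ᵥ (∫ ω, x0 ω ∂μ)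
      + ∫ ω, (x0 ω - ∫ ω, x0 ω ∂μ) ⬝ᵥ
          ((1 - p) • Z + p • X) *ᵥ (x0 ω - ∫ ω, x0 ω ∂μ) ∂μ := by
  have hestimate : estimate μ η x 0 =ᵐ[μ] μ[x0 | ⊥ ⊔
      MeasurableSpace.comap (fun ω => received (η 0 ω) (x0 ω)) inferInstance] := by
    rw [estimate, remoteSigma_zero, hx0]
  have hupdate := integral_dotProduct_mulVec_sup_received (bot_le (a := history x0 η 0))
    (hset.history_le 0) (hset.measurable_η 0) (hset.indep_history 0) measurable_history_zero
    hset.memLp_x0 hp (hset.prob_loss 0) Z X hestimate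
  rw [condExp_bot, integral_const, probReal_univ, one_smul] at hupdate
  simpa only [expectedValue, estError, hx0] using hupdate

end InitialValue

section TestSettings

variable {n : ℕ}

theorem exists_isGaussian_rankOne (v w : Fin n → ℝ) : ∃ P : Measure (Fin n → ℝ), IsGaussian P ∧
    ∫ y, y ∂P = v ∧ ∀ S : Matrix (Fin n) (Fin n) ℝ,
      ∫ y, (y - v) ⬝ᵥ S *ᵥ (y - v) ∂P = w ⬝ᵥ S *ᵥ w := by
  have hline : Measurable fun t : ℝ => v + t • w := by fun_prop
  have hmean : ∫ t, t ∂gaussianReal 0 1 = 0 := integral_id_gaussianReal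
  have hsq : ∫ t, t ^ 2 ∂gaussianReal 0 1 = 1 := by
    have hvar := variance_id_gaussianReal (μ := 0) (v := 1)
    rw [variance_of_integral_eq_zero aemeasurable_id integral_id_gaussianReal] at hvar
    exact hvar
  refine ⟨(gaussianReal 0 1).map fun t => v + t • w, ?_, ?_, fun S => ?_⟩
  · have hmap : (gaussianReal 0 1).map (fun t => v + t • w) = ((gaussianReal 0 1).map
        (ContinuousLinearMap.smulRight (1 : ℝ →L[ℝ] ℝ) w)).map (fun y => v + y) :=
      (Measure.map_map (by fun_prop) (by fun_prop)).symm
    rw [hmap]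
    infer_instance
  · have hint : Integrable (fun t : ℝ => t) (gaussianReal 0 1) :=
      IsGaussian.memLp_two_id.integrable one_le_two
    rw [integral_map hline.aemeasurable (f := fun y => y) (by fun_prop),
      integral_add (integrable_const v) (hint.smul_const w), integral_smul_const, hmean]
    simp
  · have hquad (t : ℝ) : (v + t • w - v) ⬝ᵥ S *ᵥ (v + t • w - v) = t ^ 2 * (w ⬝ᵥ S *ᵥ w) := by
      rw [add_sub_cancel_left, mulVec_smul, dotProduct_smul, smul_dotProduct, smul_eq_mul,
        smul_eq_mul]
      ring
    have hmeas : Measurable fun y : Fin n → ℝ => (y - v) ⬝ᵥ S *ᵥ (y - v) :=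
      measurable_dotProduct (measurable_id.sub_const v)
        (measurable_mulVec (measurable_id.sub_const v) S)
    rw [integral_map hline.aemeasurable hmeas.aestronglyMeasurable]
    simp_rw [hquad]
    rw [integral_mul_const, hsq, one_mul]

theorem isSetting_prod_infinitePi {p : ℝ} (P : Measure (Fin n → ℝ)) [IsGaussian P]
    (ν : Measure Bool) [IsProbabilityMeasure ν] (hν : ν {false} = ENNReal.ofReal p) :
    IsSetting (P.prod (Measure.infinitePi fun _ : ℕ => ν)) p Prod.fst fun k ω => ω.2 k := by
  set channel := Measure.infinitePi fun _ : ℕ => ν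
  have hη (k : ℕ) : MeasurePreserving (fun ω : (Fin n → ℝ) × (ℕ → Bool) => ω.2 k)
      (P.prod channel) ν :=
    (measurePreserving_eval_infinitePi (fun _ => ν) k).comp measurePreserving_snd
  have hηmeas (k : ℕ) := (hη k).measurable
  refine ⟨measurable_fst, ?_, hηmeas, fun k => ?_, ?_, ?_⟩
  · rw [measurePreserving_fst.map_eq]
    infer_instance
  · exact ((hη k).measure_preimage (MeasurableSet.singleton false).nullMeasurableSet).trans hν
  · rw [iIndepFun_iff_map_fun_eq_infinitePi_map hηmeas]
    simp_rw [(hη _).map_eq]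
    exact measurePreserving_snd.map_eq
  · exact indepFun_prod (X := id) (Y := id) measurable_id measurable_id

theorem exists_isSetting_rankOne {p : ℝ} (hp0 : 0 ≤ p) (hp1 : p ≤ 1) (v w : Fin n → ℝ) :
    ∃ (Ω : Type) (_ : MeasurableSpace Ω) (μ : Measure Ω) (_ : IsProbabilityMeasure μ)
      (x0 : Ω → Fin n → ℝ) (η : ℕ → Ω → Bool), IsSetting μ p x0 η ∧ ∫ ω, x0 ω ∂μ = v ∧
        ∀ S : Matrix (Fin n) (Fin n) ℝ, ∫ ω, (x0 ω - v) ⬝ᵥ S *ᵥ (x0 ω - v) ∂μ = w ⬝ᵥ S *ᵥ w := by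
  obtain ⟨P, hP, hmean, hcov⟩ := exists_isGaussian_rankOne v w
  let ν : Measure Bool := bernoulliMeasure false true ⟨p, hp0, hp1⟩
  have hν : ν {false} = ENNReal.ofReal p :=
    (bernoulliMeasure_apply_of_mem_of_notMem _ (.singleton false) rfl
      (by decide : true ∉ ({false} : Set Bool))).trans (ENNReal.ofReal_eq_coe_nnreal hp0).symm
  refine ⟨(Fin n → ℝ) × (ℕ → Bool), inferInstance, P.prod (Measure.infinitePi fun _ => ν),
    inferInstance, Prod.fst, _, isSetting_prod_infinitePi P ν hν, ?_, fun S => ?_⟩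
  · exact (integral_fun_fst fun y => y).trans (by rw [probReal_univ, one_smul, hmean])
  · exact (integral_fun_fst fun y => (y - v) ⬝ᵥ S *ᵥ (y - v)).trans
      (by rw [probReal_univ, one_smul, hcov])

end TestSettings

namespace NCS

section ClosedLoopMoments

variable {n l r : ℕ} {S : NCS n l r} {Ω : Type*} [MeasurableSpace Ω] {μ : Measure Ω}
  [IsProbabilityMeasure μ] {x0 : Ω → Fin n → ℝ} {η : ℕ → Ω → Bool}
  {K1 : Matrix (Fin r) (Fin n) ℝ} {K2 L : Matrix (Fin l) (Fin n) ℝ}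

theorem integral_closedLoop (hset : IsSetting μ S.p x0 η) (k : ℕ) :
    ∫ ω, S.closedLoop μ x0 η K1 K2 L k ω ∂μ
      = (S.A - S.B * fromRows K2 K1) ^ k *ᵥ ∫ ω, x0 ω ∂μ := by
  have hsq := isSquareIntegrable_closedLoop hset K1 K2 L
  have hjoint := jointControl_closedLoop hset K1 K2 L rfl
  set x := S.closedLoop μ x0 η K1 K2 L
  induction k with
  | zero => rw [hsq.isAdmissible.1.1, pow_zero, one_mulVec]
  | succ k ih =>
    have hm := hsq.remoteSigma_le k
    have hstep : μ[x (k + 1) | remoteSigma η x k] =ᵐ[μ]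
        fun ω => (S.A - S.B * fromRows K2 K1) *ᵥ estimate μ η x k ω := by
      filter_upwards [hsq.condExp_succ k, hjoint k] with ω hsucc hω
      rw [hsucc, hω, mulVec_neg, mulVec_mulVec, sub_mulVec, sub_eq_add_neg]
    rw [← integral_condExp hm, integral_congr_ae hstep,
      integral_mulVec ((memLp_estimate (hsq.memLp_x k)).integrable one_le_two), estimate,
      integral_condExp hm, ih, mulVec_mulVec, ← pow_succ']

theorem expectedValue_closedLoop (hp : 0 ≤ S.p) (hset : IsSetting μ S.p x0 η) (k : ℕ)
    (T : Matrix (Fin n) (Fin n) ℝ) :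
    expectedValue μ η (S.closedLoop μ x0 η K1 K2 L) 0 T k = S.p ^ k *
      expectedValue μ η (S.closedLoop μ x0 η K1 K2 L) 0
        (((S.A - S.BL * L) ^ k)ᵀ * T * (S.A - S.BL * L) ^ k) 0 := by
  have hsq := isSquareIntegrable_closedLoop hset K1 K2 L
  have hcontrol := controlError_closedLoop hset K1 K2 L rfl
  set x := S.closedLoop μ x0 η K1 K2 L
  induction k generalizing T with
  | zero => simp
  | succ k ih =>
    set F := S.A - S.BL * L
    have hstep : ∫ ω, (S.A *ᵥ estError μ η x k ω + S.BL *ᵥ controlError μ η x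
          (localFeedback μ η K2 L x) k ω) ⬝ᵥ S.Psi 0 T *ᵥ (S.A *ᵥ estError μ η x k ω
          + S.BL *ᵥ controlError μ η x (localFeedback μ η K2 L x) k ω) ∂μ
        = S.p * expectedValue μ η x 0 (Fᵀ * T * F) k := by
      rw [expectedValue, ← integral_const_mul]
      refine integral_congr_ae ?_
      filter_upwards [hcontrol k] with ω hω
      rw [hω, mulVec_neg, mulVec_mulVec, ← sub_eq_add_neg, ← sub_mulVec,
        dotProduct_transpose_mul_mul_mulVec, Psi, smul_zero, zero_add, smul_mulVec,
        dotProduct_smul, smul_eq_mul, zero_mulVec, dotProduct_zero, zero_add]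
    rw [hsq.expectedValue_succ hp, hstep, ih, ← mul_assoc, ← pow_succ', pow_succ' F,
      transpose_mul]
    simp only [zero_mulVec, dotProduct_zero, integral_zero, zero_add, Matrix.mul_assoc]

end ClosedLoopMoments

section Stabilizing

variable {n l r : ℕ} {S : NCS n l r} {K1 : Matrix (Fin r) (Fin n) ℝ}
  {K2 L : Matrix (Fin l) (Fin n) ℝ}

theorem StabilizedBy.tendsto_pow_estimate (h : S.StabilizedBy K1 K2 L) (hp0 : 0 ≤ S.p)
    (hp1 : S.p ≤ 1) (v : Fin n → ℝ) :
    Tendsto (fun k : ℕ => (S.A - S.B * fromRows K2 K1) ^ k *ᵥ v ⬝ᵥ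
      (S.A - S.B * fromRows K2 K1) ^ k *ᵥ v) atTop (𝓝 0) := by
  obtain ⟨Ω, _, μ, _, x0, η, hset, hmean, -⟩ := exists_isSetting_rankOne hp0 hp1 v 0
  have hms : MSTendstoZero μ (S.closedLoop μ x0 η K1 K2 L) := h Ω μ x0 η hset
  have hx := (isSquareIntegrable_closedLoop hset K1 K2 L).memLp_x
  refine squeeze_zero (fun k => dotProduct_self_nonneg _) (fun k => ?_) (hms.tendsto_integral hx)
  have hsplit := integral_dotProduct_mulVec_eq_condExp_add_residual bot_le (hx k) 1
  rw [condExp_bot, integral_closedLoop hset k, hmean, integral_const, probReal_univ,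
    one_smul] at hsplit
  have hresidual := integral_dotProduct_mulVec_self_nonneg (μ := μ)
    (PosSemidef.one (n := Fin n) (R := ℝ)) fun ω =>
      S.closedLoop μ x0 η K1 K2 L k ω - (S.A - S.B * fromRows K2 K1) ^ k *ᵥ v
  simp only [one_mulVec] at hsplit hresidual
  linarith

theorem StabilizedBy.tendsto_pow_estError (h : S.StabilizedBy K1 K2 L) (hp0 : 0 ≤ S.p)
    (hp1 : S.p ≤ 1) (w : Fin n → ℝ) :
    Tendsto (fun k : ℕ => S.p ^ k *
      ((S.A - S.BL * L) ^ k *ᵥ w ⬝ᵥ (S.A - S.BL * L) ^ k *ᵥ w)) atTop (𝓝 0) := by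
  rcases hp0.eq_or_lt with hp | hp
  · refine tendsto_const_nhds.congr' ?_
    filter_upwards [eventually_gt_atTop 0] with k hk
    rw [← hp, zero_pow hk.ne', zero_mul]
  obtain ⟨Ω, _, μ, _, x0, η, hset, hmean, hcov⟩ := exists_isSetting_rankOne hp0 hp1 0 w
  have hms : MSTendstoZero μ (S.closedLoop μ x0 η K1 K2 L) := h Ω μ x0 η hset
  have hsq := isSquareIntegrable_closedLoop hset K1 K2 L
  have herror (k : ℕ) : expectedValue μ η (S.closedLoop μ x0 η K1 K2 L) 0 1 k
      = S.p * (S.p ^ k * ((S.A - S.BL * L) ^ k *ᵥ w ⬝ᵥ (S.A - S.BL * L) ^ k *ᵥ w)) := by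
    rw [expectedValue_closedLoop hp0 hset, expectedValue_zero hp0 hset hsq.isAdmissible.1.1, hmean,
      hcov, smul_zero, zero_add, zero_dotProduct, zero_add, smul_mulVec, dotProduct_smul,
      dotProduct_transpose_mul_mul_mulVec, one_mulVec, smul_eq_mul, mul_left_comm]
  have hbound (k : ℕ) : expectedValue μ η (S.closedLoop μ x0 η K1 K2 L) 0 1 k
      ≤ ∫ ω, S.closedLoop μ x0 η K1 K2 L k ω ⬝ᵥ S.closedLoop μ x0 η K1 K2 L k ω ∂μ := by
    have hself := expectedValue_self (hsq.remoteSigma_le k) (hsq.memLp_x k) 1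
    simp only [one_mulVec] at hself
    exact hself ▸ expectedValue_mono (hsq.memLp_x k) PosSemidef.one.nonneg le_rfl
  have hlim := (squeeze_zero (fun k => expectedValue_nonneg PosSemidef.zero PosSemidef.one k)
    hbound (hms.tendsto_integral hsq.memLp_x)).const_mul S.p⁻¹
  simpa only [herror, inv_mul_cancel_left₀ hp.ne', mul_zero] using hlim

theorem StabilizedBy.exists_isRiccatiSolution (h : S.StabilizedBy K1 K2 L) (hp0 : 0 ≤ S.p)
    (hp1 : S.p ≤ 1) (hQ : S.Q.PosSemidef) (hRL : S.RL.PosDef) (hRR : S.RR.PosDef)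
    (hobs : Observable S.A (CFC.sqrt S.Q)) :
    ∃ Z X : Matrix (Fin n) (Fin n) ℝ, S.IsRiccatiSolution Z X := by
  have hR := posDef_blockR hRL hRR
  obtain ⟨Z, hZ, hfixZ⟩ := exists_eq_riccatiMap hR hQ PosSemidef.zero zero_le_one (fromRows K2 K1)
    fun v => by simpa only [one_pow, one_mul] using h.tendsto_pow_estimate hp0 hp1 v
  rw [one_smul, zero_add] at hfixZ
  have hposZ := posDef_of_eq_riccatiMap hR hQ hZ hfixZ hobs
  obtain ⟨X, hX, hfixX⟩ := exists_eq_riccatiMap hRL hQ (hZ.smul (sub_nonneg.mpr hp1)) hp0 L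
    (h.tendsto_pow_estError hp0 hp1)
  have hΨ : (S.Psi Z X).PosDef := by
    rcases hp1.eq_or_lt with hp | hp
    · have hΨX : S.Psi Z X = X := by rw [Psi, hp, sub_self, zero_smul, zero_add, one_smul]
      rw [hΨX]
      exact posDef_of_eq_riccatiMap hRL hQ hX (hfixX.trans (congrArg _ hΨX)) hobs
    · exact (hposZ.smul (sub_pos.mpr hp)).add_posSemidef (hX.smul hp0)
  refine ⟨Z, X, hfixZ.trans (riccatiMap_eq_sub_K hRL hRR hZ), hfixX, hposZ, hΨ, ?_⟩
  intro Ω _ μ _ x0 η hset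
  rw [initialValue_eq_expectedValue (x := fun _ => x0) hset rfl]
  exact expectedValue_nonneg hZ hX 0

end Stabilizing

section Optimal

variable {n l r : ℕ} {S : NCS n l r} {Z X : Matrix (Fin n) (Fin n) ℝ} (hp0 : 0 ≤ S.p)
  (hQ : S.Q.PosSemidef) (hRL : S.RL.PosDef) (hRR : S.RR.PosDef)
  (hobs : Observable S.A (CFC.sqrt S.Q))
include hp0 hQ hRL hRR hobs

section Setting

variable {Ω : Type*} [MeasurableSpace Ω] {μ : Measure Ω} [IsProbabilityMeasure μ]
  {x0 : Ω → Fin n → ℝ} {η : ℕ → Ω → Bool}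

theorem IsRiccatiSolution.initialValue_le_cost (h : S.IsRiccatiSolution Z X)
    (hset : IsSetting μ S.p x0 η) {uL : ℕ → Ω → Fin l → ℝ} {uR : ℕ → Ω → Fin r → ℝ}
    {x : ℕ → Ω → Fin n → ℝ} (hadm : S.IsAdmissible x0 η uL uR x) :
    ENNReal.ofReal (initialValue μ x0 η Z X) ≤ S.cost μ uL uR x := by
  rw [initialValue_eq_expectedValue hset hadm.1.1]
  exact hadm.expectedValue_le_cost hp0 hQ hRL hRR (h.isBellmanPair hRL hRR) hset hobs

theorem IsRiccatiSolution.cost_closedLoop (h : S.IsRiccatiSolution Z X)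
    (hset : IsSetting μ S.p x0 η) {x : ℕ → Ω → Fin n → ℝ}
    (hx : x = S.closedLoop μ x0 η (S.remoteGain Z) (S.localGain Z) (S.errorGain Z X)) :
    S.cost μ (localFeedback μ η (S.localGain Z) (S.errorGain Z X) x)
      (remoteFeedback μ η (S.remoteGain Z) x) x = ENNReal.ofReal (initialValue μ x0 η Z X) := by
  have hadm := S.isAdmissible_closedLoop μ x0 η (S.remoteGain Z) (S.localGain Z) (S.errorGain Z X)
  rw [← hx] at hadm
  refine le_antisymm ?_ (h.initialValue_le_cost hp0 hQ hRL hRR hobs hset hadm)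
  rw [initialValue_eq_expectedValue hset hadm.1.1]
  exact cost_closedLoop_le hp0 hQ hRL hRR (h.isBellmanPair hRL hRR) hset hx

end Setting

theorem IsRiccatiSolution.stabilizedBy (h : S.IsRiccatiSolution Z X) :
    S.StabilizedBy (S.remoteGain Z) (S.localGain Z) (S.errorGain Z X) := by
  intro Ω _ μ _ x0 η hset
  have hcost := h.cost_closedLoop hp0 hQ hRL hRR hobs hset rfl
  exact (S.isAdmissible_closedLoop μ x0 η _ _ _).msTendstoZero_x hQ hRL hRR hset hobs
    (hcost ▸ ENNReal.ofReal_ne_top)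

theorem IsRiccatiSolution.unique {Z' X' : Matrix (Fin n) (Fin n) ℝ}
    (h : S.IsRiccatiSolution Z X) (h' : S.IsRiccatiSolution Z' X') (hp1 : S.p ≤ 1) :
    Z = Z' ∧ X = X' := by
  have hvalue (v w : Fin n → ℝ) : v ⬝ᵥ Z *ᵥ v + w ⬝ᵥ S.Psi Z X *ᵥ w
      = v ⬝ᵥ Z' *ᵥ v + w ⬝ᵥ S.Psi Z' X' *ᵥ w := by
    obtain ⟨Ω, _, μ, _, x0, η, hset, hmean, hcov⟩ := exists_isSetting_rankOne hp0 hp1 v w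
    have hinitial (Y T : Matrix (Fin n) (Fin n) ℝ) :
        initialValue μ x0 η Y T = v ⬝ᵥ Y *ᵥ v + w ⬝ᵥ S.Psi Y T *ᵥ w := by
      rw [initialValue_eq_expectedValue (x := fun _ => x0) hset rfl,
        expectedValue_zero hp0 hset rfl, hmean, hcov, Psi]
    have hle {Y T Y' T' : Matrix (Fin n) (Fin n) ℝ} (hY : S.IsRiccatiSolution Y T)
        (hY' : S.IsRiccatiSolution Y' T') :
        ENNReal.ofReal (initialValue μ x0 η Y T) ≤ ENNReal.ofReal (initialValue μ x0 η Y' T') :=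
      (hY.initialValue_le_cost hp0 hQ hRL hRR hobs hset
        (S.isAdmissible_closedLoop μ x0 η _ _ _)).trans_eq
          (hY'.cost_closedLoop hp0 hQ hRL hRR hobs hset rfl)
    rw [← hinitial, ← hinitial, ← ENNReal.ofReal_eq_ofReal_iff (h.nonneg _ _ _ _ hset)
      (h'.nonneg _ _ _ _ hset)]
    exact (hle h h').antisymm (hle h' h)
  have hZ : Z = Z' := eq_of_forall_dotProduct_mulVec_eq h.posDef_Z.isHermitian
    h'.posDef_Z.isHermitian fun v => by simpa using hvalue v 0
  have hΨ : S.Psi Z X = S.Psi Z' X' := eq_of_forall_dotProduct_mulVec_eq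
    h.posDef_Psi.isHermitian h'.posDef_Psi.isHermitian fun w => by simpa using hvalue 0 w
  have hX := (h.isBellmanPair hRL hRR).eq_X
  have hX' := (h'.isBellmanPair hRL hRR).eq_X
  exact ⟨hZ, by rw [hX, hX', hΨ]⟩

end Optimal

end NCS

theorem theorem2 {n l r m : ℕ} (S : NCS n l r)
    (hp0 : 0 ≤ S.p) (hp1 : S.p ≤ 1)
    (hRL : S.RL.PosDef) (hRR : S.RR.PosDef)
    (C : Matrix (Fin m) (Fin n) ℝ) (hQ : S.Q = Cᵀ * C)
    (hobs : Observable S.A (CFC.sqrt S.Q)) :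
    (S.MeanSquareStabilizable ↔
      ∃! ZX : Matrix (Fin n) (Fin n) ℝ × Matrix (Fin n) (Fin n) ℝ,
        S.IsRiccatiSolution ZX.1 ZX.2) ∧
    ∀ Z X : Matrix (Fin n) (Fin n) ℝ, S.IsRiccatiSolution Z X →
      S.StabilizedBy (S.remoteGain Z) (S.localGain Z) (S.errorGain Z X) ∧
      ∀ (Ω : Type) [MeasurableSpace Ω] (μ : Measure Ω) [IsProbabilityMeasure μ]
        (x0 : Ω → Fin n → ℝ) (η : ℕ → Ω → Bool), IsSetting μ S.p x0 η →
        ∀ x : ℕ → Ω → Fin n → ℝ,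
          x = S.closedLoop μ x0 η (S.remoteGain Z) (S.localGain Z) (S.errorGain Z X) →
        ∀ (uL : ℕ → Ω → Fin l → ℝ) (uR : ℕ → Ω → Fin r → ℝ),
          uL = localFeedback μ η (S.localGain Z) (S.errorGain Z X) x →
          uR = remoteFeedback μ η (S.remoteGain Z) x →
          S.IsAdmissible x0 η uL uR x ∧
          S.cost μ uL uR x = ENNReal.ofReal (NCS.initialValue μ x0 η Z X) ∧
          ∀ (vL : ℕ → Ω → Fin l → ℝ) (vR : ℕ → Ω → Fin r → ℝ) (x' : ℕ → Ω → Fin n → ℝ),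
            S.IsAdmissible x0 η vL vR x' →
            S.cost μ uL uR x ≤ S.cost μ vL vR x' := by
  have hQ' : S.Q.PosSemidef := hQ ▸ posSemidef_conjTranspose_mul_self C
  refine ⟨⟨?_, ?_⟩, fun Z X h => ⟨h.stabilizedBy hp0 hQ' hRL hRR hobs, ?_⟩⟩
  · rintro ⟨K1, K2, L, hstab⟩
    obtain ⟨Z, X, h⟩ := hstab.exists_isRiccatiSolution hp0 hp1 hQ' hRL hRR hobs
    exact ⟨(Z, X), h, fun ZX h' =>
      Prod.ext_iff.mpr (NCS.IsRiccatiSolution.unique hp0 hQ' hRL hRR hobs h' h hp1)⟩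
  · rintro ⟨ZX, h, -⟩
    exact ⟨_, _, _, NCS.IsRiccatiSolution.stabilizedBy hp0 hQ' hRL hRR hobs h⟩
  · rintro Ω _ μ _ x0 η hset x rfl uL uR rfl rfl
    have hcost := h.cost_closedLoop hp0 hQ' hRL hRR hobs hset rfl
    exact ⟨S.isAdmissible_closedLoop μ x0 η _ _ _, hcost, fun vL vR x' hadm =>
      hcost.trans_le (h.initialValue_le_cost hp0 hQ' hRL hRR hobs hset hadm)⟩
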